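/- A *(row-finite) weighted graph* $(E,\omega)$ consists of countable sets $E^0$ (vertices) and $E^{\mathrm{st}}$ (structured edges), maps $s,r:E^{\mathrm{st}}\to E^0$ such that $s^{-1}(v)$ is finite for every $v\in E^0$, and a weight map $\omega:E^{\mathrm{st}}\to\{1,2,3,\dots\}$. Its edges are distinct symbols $\alpha_i$ ($\alpha\in E^{\mathrm{st}}$, $1\le i\le\omega(\alpha)$); $\alpha_i$ goes from $s(\alpha)$ to $r(\alpha)$, and the ghost edge $\alpha_i^*$ goes from $r(\alpha)$ to $s(\alpha)$. For a vertex $v$ with $s^{-1}(v)\neq\emptyset$ put $\omega(v)=\max\{\omega(\alpha)\mid \alpha\in s^{-1}(v)\}$. $(E,\omega)$ is an *LV-graph* if $\omega(\alpha)\ge 2$ for all $\alpha\in E^{\mathrm{st}}$; $|\{\alpha\in s^{-1}(v)\mid\omega(\alpha)=\omega(v)\}|\ge 2$ for every $v\in E^0$ with $s^{-1}(v)\ne\emptyset$; $E^{\mathrm{st}}\neq\emptyset$; and $(E,\omega)$ is connected, i.e. any two vertices $u,v$ are joined by a generalised path (a trivial path if $u=v$, or a finite composable sequence of edges and ghost edges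 from $u$ to $v$). For a unital, not necessarily commutative ring $R$, the *weighted Leavitt path algebra* $L_R(E,\omega)$ is the quotient of the free (non-unital) $R$-ring on the symbols $v$ ($v\in E^0$), $\alpha_i$, $\alpha_i^*$ ($\alpha\in E^{\mathrm{st}}$, $1\le i\le\omega(\alpha)$), i.e. the free left $R$-module on the nonempty words in these symbols, in which coefficients commute with words, by the two-sided ideal and $R$-subbimodule generated by the relations 1. $vw=\delta_{vw}v$ for $v,w\in E^0$; 2. $s(\alpha)\alpha_i=\alpha_i r(\alpha)=\alpha_i$ and $r(\alpha)\alpha_i^*=\alpha_i^*s(\alpha)=\alpha_i^*$ for $\alpha\in E^{\mathrm{st}}$, $1\le i\le\omega(\alpha)$; 3. $\sum_{\alpha\in s^{-1}(v)}\alpha_i\alpha_j^*=\delta_{ij}v$ for every $v\in E^0$ with $s^{-1}(v)\neq\emptyset$ and $1\le i,j\le\omega(v)$; 4. $\sum_{1\le i\le\max\{\omega(\alpha),\omega(\beta)\}}\alpha_i^*\beta_i=\delta_{\alpha\beta}r(\alpha)$ for $\alpha,\beta\in E^{\mathrm{st}}$, where in (3) and (4) $\alpha_i$ and $\alpha_i^*$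 are read as zero whenever $i>\omega(\alpha)$. **Theorem.** Let $(E,\omega)$ be an LV-graph and let $R$ be a domain (a nonzero unital ring without zero divisors, not necessarily commutative). Then $L_R(E,\omega)$ is a prime ring: it is nonzero, and for all nonzero $a,b\in L_R(E,\omega)$ there is an $x\in L_R(E,\omega)$ with $axb\neq 0$. -/

import Mathlib

universe u v w

/-- A row-finite weighted graph with vertex set `V` and set of structured edges `S`. -/
structure WeightedGraph (V : Type u) (S : Type v) where
  /-- source -/
  src : S → V
  /-- range -/
  rng : S → V
  /-- weight map, with values in the positive integers -/
  weight : S → ℕ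
  weight_pos : ∀ α, 1 ≤ weight α
  rowFinite : ∀ v : V, {α : S | src α = v}.Finite

namespace WeightedGraph

variable {V : Type u} {S : Type v}

/-- The finite set of structured edges emitted by `v`. -/
noncomputable def emitted (E : WeightedGraph V S) (v : V) : Finset S :=
  (E.rowFinite v).toFinset

/-- The maximal weight of a structured edge emitted by `v` (zero if `v` is a sink). -/
noncomputable def vertexWeight (E : WeightedGraph V S) (v : V) : ℕ :=
  (E.emitted v).sup E.weight

/-- A vertex is a sink if it emits no structured edge. -/
def IsSink (E : WeightedGraph V S) (v : V) : Prop :=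
  ∀ α : S, E.src α ≠ v

/-- `E.GenReach u v`: there is a generalised path from `u` to `v`, i.e. a trivial path (`u = v`) or
a word in the edges and ghost edges whose consecutive letters are composable. A ghost edge
`α_i^*` goes from the range of `α` to its source. -/
inductive GenReach (E : WeightedGraph V S) : V → V → Prop
  | trivial (v : V) : GenReach E v v
  | edge {u : V} (α : S) (i : Fin (E.weight α)) :
      GenReach E u (E.src α) → GenReach E u (E.rng α)
  | ghost {u : V} (α : S) (i : Fin (E.weight α)) :
      GenReach E u (E.rng α) → GenReach E u (E.src α)

/-- There is exactly one connected component. -/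
def Connected (E : WeightedGraph V S) : Prop :=
  Nonempty V ∧ ∀ u v : V, E.GenReach u v

/-- LV-graphs: every structured edge has weight at least two, every vertex that is not a sink
emits at least two structured edges of maximal weight, there is at least one structured edge,
and the graph is connected. -/
structure IsLVGraph (E : WeightedGraph V S) : Prop where
  two_le_weight : ∀ α : S, 2 ≤ E.weight α
  two_le_max : ∀ v : V, ¬ E.IsSink v →
    2 ≤ Set.encard {α : S | E.src α = v ∧ E.weight α = E.vertexWeight v}
  nonempty_edges : Nonempty S
  connected : E.Connected

/-- The generators: vertices, edges `α_i` and ghost edges `α_i^*`. The index `i` of an edge runs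
through `0, …, ω(α) - 1` instead of `1, …, ω(α)`. -/
inductive Generator (E : WeightedGraph V S) : Type (max u v)
  | vertex (v : V) : Generator E
  | edge (α : S) (i : Fin (E.weight α)) : Generator E
  | ghost (α : S) (i : Fin (E.weight α)) : Generator E

/-- The free (non-unital) `R`-ring on the generators: formal left linear combinations of nonempty
words, where coefficients commute with words. -/
abbrev FreeRRing (R : Type w) [Ring R] (E : WeightedGraph V S) : Type (max u v w) :=
  MonoidAlgebra R (FreeSemigroup E.Generator)

section Generators

variable (R : Type w) [Ring R] (E : WeightedGraph V S)

/-- A generator as an element of the free `R`-ring. -/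
noncomputable def gen (x : E.Generator) : FreeRRing R E :=
  MonoidAlgebra.single (FreeSemigroup.of x) 1

/-- The vertex `v` in the free `R`-ring. -/
noncomputable def vtx (v : V) : FreeRRing R E :=
  gen R E (.vertex v)

/-- The edge with index `i` of `α`, with the convention that it is zero if `i` is out of range. -/
noncomputable def edg (α : S) (i : ℕ) : FreeRRing R E :=
  if h : i < E.weight α then gen R E (.edge α ⟨i, h⟩) else 0

/-- The ghost edge with index `i` of `α`, with the same convention. -/
noncomputable def gho (α : S) (i : ℕ) : FreeRRing R E :=
  if h : i < E.weight α then gen R E (.ghost α ⟨i, h⟩) else 0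

open Classical in
/-- The defining relations `lhs = rhs` of the weighted Leavitt path algebra. -/
inductive LeavittRel : FreeRRing R E → FreeRRing R E → Prop
  | vertex_mul (v w : V) :
      LeavittRel (vtx R E v * vtx R E w) (if v = w then vtx R E v else 0)
  | src_mul_edge (α : S) (i : ℕ) (hi : i < E.weight α) :
      LeavittRel (vtx R E (E.src α) * edg R E α i) (edg R E α i)
  | edge_mul_rng (α : S) (i : ℕ) (hi : i < E.weight α) :
      LeavittRel (edg R E α i * vtx R E (E.rng α)) (edg R E α i)
  | rng_mul_ghost (α : S) (i : ℕ) (hi : i < E.weight α) :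
      LeavittRel (vtx R E (E.rng α) * gho R E α i) (gho R E α i)
  | ghost_mul_src (α : S) (i : ℕ) (hi : i < E.weight α) :
      LeavittRel (gho R E α i * vtx R E (E.src α)) (gho R E α i)
  | sum_edge_ghost (v : V) (i j : ℕ) (hi : i < E.vertexWeight v) (hj : j < E.vertexWeight v) :
      LeavittRel (∑ α ∈ E.emitted v, edg R E α i * gho R E α j) (if i = j then vtx R E v else 0)
  | sum_ghost_edge (α β : S) :
      LeavittRel (∑ i ∈ Finset.range (max (E.weight α) (E.weight β)), gho R E α i * edg R E β i)
        (if α = β then vtx R E (E.rng α) else 0)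

/-- The ideal of the free `R`-ring generated by the defining relations: the smallest two-sided
ideal that is an `R`-subbimodule and contains `lhs - rhs` for each relation. -/
noncomputable def leavittIdeal : TwoSidedIdeal (FreeRRing R E) :=
  sInf {J | (∀ (r : R), ∀ x ∈ J, r • x ∈ J) ∧ (∀ (r : R), ∀ x ∈ J, MulOpposite.op r • x ∈ J) ∧
    ∀ a b, LeavittRel R E a b → a - b ∈ J}

/-- The weighted Leavitt path algebra of `E` with coefficients in `R`. -/
def LeavittPathAlgebra : Type (max u v w) :=
  (leavittIdeal R E).ringCon.Quotient

noncomputable instance : NonUnitalRing (LeavittPathAlgebra R E) :=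
  inferInstanceAs (NonUnitalRing (leavittIdeal R E).ringCon.Quotient)

end Generators

end WeightedGraph

/-- A (not necessarily unital) ring `A` is prime if it is nonzero and `a A b = 0` implies `a = 0`
or `b = 0`. -/
def IsPrimeRing (A : Type u) [NonUnitalRing A] : Prop :=
  Nontrivial A ∧ ∀ a b : A, (∀ x : A, a * x * b = 0) → a = 0 ∨ b = 0

/-!
Fix at every vertex a special edge of maximal weight. Relations (3) and (4) rewrite the words
`α_i α_j^*` with `α` special and the words `α_1^* β_1` as combinations of other words; these
reductions are confluent, so that the paths that are irreducible and end at a vertex `v` are the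
basis of a module on which the Leavitt path algebra acts by left multiplication followed by
reduction.

Let `p` and `q` be words of maximal length in `m`, a combination of irreducible paths ending at `u`,
and in `n`, one of irreducible paths that start at `u`. If `p q` is irreducible and is not produced
by a reduction, its coefficient in `m n` is the product of the coefficients of `p` and `q`.
Otherwise one exchanges the two letters at the junction by means of a reduction. The exchange exists
because every weight is at least two and because every vertex that is not a sink emits two edges of
maximal weight. If `p' q'` is the word obtained in this way, no reduction takes part in the mixed
word `p q'`. Thus `m r n ≠ 0` for some scalar `r`, and connectedness leads from one vertex to any
other.
-/

namespace WeightedGraph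

/-! ### Irreducible paths -/

variable {V : Type u} {S : Type v}

/-- The letters of generalised paths: the edges `α_i` and the ghost edges `α_i^*`. Every natural
number is allowed as an index; the letters that belong to a weighted graph are the `Valid` ones. -/
inductive Letter (S : Type v) : Type v
  | edge (α : S) (i : ℕ)
  | ghost (α : S) (i : ℕ)

namespace Letter

/-- The involution that exchanges `α_i` and `α_i^*`. -/
def star : Letter S → Letter S
  | edge α i => ghost α i
  | ghost α i => edge α i

/-- The vertex at which a letter starts. -/
def src (E : WeightedGraph V S) : Letter S → V
  | edge α _ => E.src α
  | ghost α _ => E.rng α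

/-- The vertex at which a letter ends. -/
def rng (E : WeightedGraph V S) : Letter S → V
  | edge α _ => E.rng α
  | ghost α _ => E.src α

/-- The index of a letter is in range. -/
def Valid (E : WeightedGraph V S) : Letter S → Prop
  | edge α i => i < E.weight α
  | ghost α i => i < E.weight α

lemma rng_star (E : WeightedGraph V S) (x : Letter S) : x.star.rng E = x.src E := by
  cases x <;> rfl

end Letter

/-- The vertex at which the word `l`, thought of as a generalised path ending at `v`, starts. -/
def pathSrc (E : WeightedGraph V S) : List (Letter S) → V → V
  | [], v => v
  | x :: _, _ => x.src E

variable {E : WeightedGraph V S}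

lemma pathSrc_append (l k : List (Letter S)) (v : V) :
    pathSrc E (l ++ k) v = pathSrc E l (pathSrc E k v) := by
  cases l <;> rfl

lemma mem_emitted {α : S} {v : V} : α ∈ E.emitted v ↔ E.src α = v := by
  simp [emitted]

lemma weight_le_vertexWeight (α : S) : E.weight α ≤ E.vertexWeight (E.src α) :=
  Finset.le_sup (f := E.weight) (mem_emitted.2 rfl)

lemma exists_src_eq_of_lt_vertexWeight {u : V} {i : ℕ} (hi : i < E.vertexWeight u) :
    ∃ α, E.src α = u := by
  obtain ⟨α, hα, -⟩ := (Finset.lt_sup_iff (f := E.weight)).1 hi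
  exact ⟨α, mem_emitted.1 hα⟩

/-- A choice of an edge of maximal weight among the edges emitted by each vertex that is not a
sink. The value of `special` at a sink is irrelevant. -/
structure SpecialEdges (E : WeightedGraph V S) where
  /-- the chosen edge -/
  special : V → S
  src_special (α : S) : E.src (special (E.src α)) = E.src α
  weight_special (α : S) : E.weight (special (E.src α)) = E.vertexWeight (E.src α)

lemma nonempty_specialEdges [Nonempty S] : Nonempty E.SpecialEdges := by
  have exists_max (v : V) : ∃ σ, ∀ α, E.src α = v →
      E.src σ = v ∧ E.weight σ = E.vertexWeight v := by
    rcases (E.emitted v).eq_empty_or_nonempty with hv | hv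
    · refine ⟨Classical.arbitrary S, fun α hα => ?_⟩
      simpa [hv] using mem_emitted.2 hα
    · obtain ⟨σ, hσ, hmax⟩ := (E.emitted v).exists_mem_eq_sup hv E.weight
      exact ⟨σ, fun _ _ => ⟨mem_emitted.1 hσ, hmax.symm⟩⟩
  choose σ hσ using exists_max
  exact ⟨⟨σ, fun α => (hσ _ α rfl).1, fun α => (hσ _ α rfl).2⟩⟩

lemma IsLVGraph.exists_ne_weight_eq (hE : E.IsLVGraph) (α : S) :
    ∃ γ, γ ≠ α ∧ E.src γ = E.src α ∧ E.weight γ = E.vertexWeight (E.src α) := by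
  have two_le := hE.two_le_max (E.src α) fun h => h α rfl
  obtain ⟨γ, ⟨hsrc, hweight⟩, hne⟩ :=
    Set.exists_ne_of_one_lt_encard (lt_of_lt_of_le (by norm_num) two_le) α
  exact ⟨γ, hne, hsrc, hweight⟩

open Classical in
/-- Relations (3) and (4) each have a summand `x y` that is declared to be reducible;
`E.replacements x y` is the set of the other summands. -/
noncomputable def replacements (E : WeightedGraph V S) :
    Letter S → Letter S → Finset (Letter S × Letter S)
  | .edge α i, .ghost _ j =>
      ((E.emitted (E.src α)).erase α).image fun γ => (.edge γ i, .ghost γ j)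
  | .ghost α _, .edge β _ =>
      (Finset.Ico 1 (E.weight α)).image fun k => (.ghost α k, .edge β k)
  | _, _ => ∅

open Classical in
lemma sum_replacements_edge_ghost {M : Type*} [AddCommMonoid M] {σ : S} {i j : ℕ}
    (f : Letter S × Letter S → M) :
    ∑ p ∈ E.replacements (.edge σ i) (.ghost σ j), f p =
      ∑ γ ∈ (E.emitted (E.src σ)).erase σ, f (.edge γ i, .ghost γ j) :=
  Finset.sum_image fun γ _ γ' _ h => by simpa using h

open Classical in
lemma sum_replacements_ghost_edge {M : Type*} [AddCommMonoid M] {α β : S} {i j : ℕ}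
    (f : Letter S × Letter S → M) :
    ∑ p ∈ E.replacements (.ghost α i) (.edge β j), f p =
      ∑ k ∈ Finset.Ico 1 (E.weight α), f (.ghost α k, .edge β k) :=
  Finset.sum_image fun k _ k' _ h => by simpa using h

namespace SpecialEdges

variable (D : E.SpecialEdges)

/-- The reducible two-letter words: `α_i α_j^*` with `α` special, and `α_1^* β_1` for any `α` and
`β` with the same source (the index `1` of the paper is `0` here). -/
def Forbidden : Letter S → Letter S → Prop
  | .edge α _, .ghost β _ => α = β ∧ α = D.special (E.src α)
  | .ghost α i, .edge β j => i = 0 ∧ j = 0 ∧ E.src α = E.src β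
  | _, _ => False

/-- The irreducible generalised paths ending at `v`: composable words in valid letters without a
forbidden factor. They will form a basis of the left ideal generated by `v`. -/
def Normal : List (Letter S) → V → Prop
  | [], _ => True
  | x :: l, v =>
      x.Valid E ∧ x.rng E = pathSrc E l v ∧ (∀ y ∈ l.head?, ¬ D.Forbidden x y) ∧ Normal l v

variable {D} {x y x' y' z : Letter S} {l k : List (Letter S)} {u v : V}

lemma normal_nil : D.Normal [] v := trivial

lemma Normal.valid (h : D.Normal (x :: l) v) : x.Valid E := h.1

lemma Normal.rng_eq (h : D.Normal (x :: l) v) : x.rng E = pathSrc E l v := h.2.1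

lemma Normal.head (h : D.Normal (x :: l) v) : ∀ y ∈ l.head?, ¬ D.Forbidden x y := h.2.2.1

lemma Normal.tail (h : D.Normal (x :: l) v) : D.Normal l v := h.2.2.2

lemma Forbidden.cases (h : D.Forbidden x y) :
    (∃ α i j, x = .edge α i ∧ y = .ghost α j ∧ α = D.special (E.src α)) ∨
      ∃ α β, x = .ghost α 0 ∧ y = .edge β 0 ∧ E.src α = E.src β := by
  rcases x with ⟨α, i⟩ | ⟨α, i⟩ <;> rcases y with ⟨β, j⟩ | ⟨β, j⟩
  · exact h.elim
  · obtain ⟨rfl, hα⟩ := h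
    exact .inl ⟨α, i, j, rfl, rfl, hα⟩
  · obtain ⟨rfl, rfl, hsrc⟩ := h
    exact .inr ⟨α, β, rfl, rfl, hsrc⟩
  · exact h.elim

lemma Forbidden.rng_eq_src (h : D.Forbidden x y) : x.rng E = y.src E := by
  obtain ⟨α, i, j, rfl, rfl, -⟩ | ⟨α, β, rfl, rfl, hsrc⟩ := h.cases
  · rfl
  · exact hsrc

lemma Forbidden.replacements_cases (h : D.Forbidden x y) (hp : (x', y') ∈ E.replacements x y) :
    (∃ α γ i j, x = .edge α i ∧ y = .ghost α j ∧ x' = .edge γ i ∧ y' = .ghost γ j ∧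
        α = D.special (E.src α) ∧ γ ≠ α ∧ E.src γ = E.src α) ∨
      ∃ α β n, x = .ghost α 0 ∧ y = .edge β 0 ∧ x' = .ghost α n ∧ y' = .edge β n ∧
        E.src α = E.src β ∧ n ≠ 0 := by
  obtain ⟨α, i, j, rfl, rfl, hα⟩ | ⟨α, β, rfl, rfl, hsrc⟩ := h.cases
  · simp only [replacements, Finset.mem_image, Finset.mem_erase, mem_emitted, Prod.mk.injEq] at hp
    obtain ⟨γ, ⟨hne, hγ⟩, rfl, rfl⟩ := hp
    exact .inl ⟨α, γ, i, j, rfl, rfl, rfl, rfl, hα, hne, hγ⟩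
  · simp only [replacements, Finset.mem_image, Finset.mem_Ico, Prod.mk.injEq] at hp
    obtain ⟨n, ⟨hn, -⟩, rfl, rfl⟩ := hp
    exact .inr ⟨α, β, n, rfl, rfl, rfl, rfl, hsrc, Nat.one_le_iff_ne_zero.1 hn⟩

section Replacements

variable (h : D.Forbidden x y) (hp : (x', y') ∈ E.replacements x y)
include h hp

lemma Forbidden.src_replacement : x'.src E = x.src E := by
  obtain ⟨α, γ, i, j, rfl, rfl, rfl, rfl, -, -, hsrc⟩ | ⟨α, β, n, rfl, rfl, rfl, rfl, -⟩ :=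
    h.replacements_cases hp
  · exact hsrc
  · rfl

lemma Forbidden.rng_replacement : y'.rng E = y.rng E := by
  obtain ⟨α, γ, i, j, rfl, rfl, rfl, rfl, -, -, hsrc⟩ | ⟨α, β, n, rfl, rfl, rfl, rfl, -⟩ :=
    h.replacements_cases hp
  · exact hsrc
  · rfl

lemma Forbidden.rng_eq_src_replacement : x'.rng E = y'.src E := by
  obtain ⟨α, γ, i, j, rfl, rfl, rfl, rfl, -⟩ | ⟨α, β, n, rfl, rfl, rfl, rfl, hsrc, -⟩ :=
    h.replacements_cases hp
  · rfl
  · exact hsrc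

lemma Forbidden.not_forbidden_replacement : ¬ D.Forbidden x' y' := by
  obtain ⟨α, γ, i, j, rfl, rfl, rfl, rfl, hα, hne, hsrc⟩ | ⟨α, β, n, rfl, rfl, rfl, rfl, -, hn⟩ :=
    h.replacements_cases hp
  · rintro ⟨-, hγ⟩
    exact hne (by rw [hγ, hsrc, ← hα])
  · exact fun h' => hn h'.1

lemma Forbidden.of_replacement_left (hz : D.Forbidden z x') : D.Forbidden z x := by
  obtain ⟨α, γ, i, j, rfl, rfl, rfl, rfl, -, -, hsrc⟩ | ⟨α, β, n, rfl, rfl, rfl, rfl, -⟩ :=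
    h.replacements_cases hp
  · rcases z with _ | ⟨β, m⟩
    · exact hz
    · exact ⟨hz.1, hz.2.1, hz.2.2.trans hsrc⟩
  · cases z <;> exact hz

lemma Forbidden.of_replacement_right (hz : D.Forbidden y' z) : D.Forbidden y z := by
  obtain ⟨α, γ, i, j, rfl, rfl, rfl, rfl, -, -, hsrc⟩ | ⟨α, β, n, rfl, rfl, rfl, rfl, -⟩ :=
    h.replacements_cases hp
  · rcases z with ⟨β, m⟩ | _
    · exact ⟨hz.1, hz.2.1, hsrc.symm.trans hz.2.2⟩
    · exact hz
  · cases z <;> exact hz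

lemma Forbidden.normal_replacement (hl : D.Normal (y :: l) v) (hx' : x'.Valid E)
    (hy' : y'.Valid E) : D.Normal (x' :: y' :: l) v := by
  refine ⟨hx', h.rng_eq_src_replacement hp, ?_, hy', (h.rng_replacement hp).trans hl.rng_eq,
    fun z hz hz' => hl.head z hz (h.of_replacement_right hp hz'), hl.tail⟩
  rintro z ⟨⟩
  exact h.not_forbidden_replacement hp

end Replacements

lemma head_not_forbidden_or (x : Letter S) (l : List (Letter S)) :
    (∀ y ∈ l.head?, ¬ D.Forbidden x y) ∨ ∃ y k, l = y :: k ∧ D.Forbidden x y := by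
  rcases l with _ | ⟨y, k⟩
  · simp
  · by_cases hxy : D.Forbidden x y
    · exact .inr ⟨y, k, rfl, hxy⟩
    · left
      rintro _ ⟨⟩
      exact hxy

lemma normal_append_iff : D.Normal (l ++ k) v ↔ D.Normal l (pathSrc E k v) ∧ D.Normal k v ∧
    ∀ x ∈ l.getLast?, ∀ y ∈ k.head?, ¬ D.Forbidden x y := by
  induction l with
  | nil => simp [Normal]
  | cons z l ih =>
    rw [List.cons_append, Normal, Normal, ih, pathSrc_append]
    rcases l with _ | ⟨z', l⟩
    · simp only [List.nil_append, List.getLast?_singleton, List.head?_nil, Option.mem_def,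
        Option.some.injEq, forall_eq', reduceCtorEq, IsEmpty.forall_iff, implies_true, pathSrc,
        Normal]
      tauto
    · simp only [List.cons_append, List.head?_cons, List.getLast?_cons_cons]
      tauto

end SpecialEdges

/-! ### The path module -/

namespace SpecialEdges

section PathModule

variable (D : E.SpecialEdges) (R : Type w) [Ring R] (v : V)

/-- The irreducible generalised paths that end at `v`. -/
abbrev NormalPath : Type v := {l : List (Letter S) // D.Normal l v}

/-- The free left `R`-module on the irreducible generalised paths that end at `v`. It carries a
representation of the Leavitt path algebra, by left multiplication followed by reduction. -/
abbrev PathModule : Type (max v w) := D.NormalPath v →₀ R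

open Classical in
/-- The basis vector given by the word `l`, which is zero unless `l` is irreducible. -/
noncomputable def path (l : List (Letter S)) : D.PathModule R v :=
  if h : D.Normal l v then Finsupp.single ⟨l, h⟩ 1 else 0

open Classical in
/-- The coefficient of the word `l`, which is zero unless `l` is irreducible. -/
noncomputable def coeff (l : List (Letter S)) : D.PathModule R v →ₗ[R] R :=
  if h : D.Normal l v then Finsupp.lapply ⟨l, h⟩ else 0

open Classical in
/-- The result of reducing the leading forbidden factor `x y` of the word `x y l` by the relation
it stems from. -/
noncomputable def reduct (x y : Letter S) (l : List (Letter S)) : D.PathModule R v :=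
  (if y = x.star then D.path R v l else 0) -
    ∑ p ∈ E.replacements x y, D.path R v (p.1 :: p.2 :: l)

open Classical in
/-- The product of the letter `x` and the irreducible word `l`. -/
noncomputable def act (x : Letter S) : List (Letter S) → D.PathModule R v
  | [] => D.path R v [x]
  | y :: l =>
      if x.Valid E ∧ D.Forbidden x y then D.reduct R v x y l else D.path R v (x :: y :: l)

/-- Left multiplication by a letter. -/
noncomputable def letterMap (x : Letter S) : D.PathModule R v →ₗ[R] D.PathModule R v :=
  Finsupp.linearCombination R fun p : D.NormalPath v => D.act R v x p.1

open Classical in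
/-- Left multiplication by a vertex, that is, the projection onto the span of the paths that start
at this vertex. -/
noncomputable def vertexMap (u : V) : D.PathModule R v →ₗ[R] D.PathModule R v :=
  Finsupp.linearCombination R fun p : D.NormalPath v =>
    if pathSrc E p.1 v = u then D.path R v p.1 else 0

end PathModule

variable {D : E.SpecialEdges} {R : Type w} [Ring R] {u v : V} {x y : Letter S}
  {l k : List (Letter S)}

lemma path_of_normal (h : D.Normal l v) : D.path R v l = Finsupp.single ⟨l, h⟩ 1 := dif_pos h

lemma path_of_not_normal (h : ¬ D.Normal l v) : D.path R v l = 0 := dif_neg h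

lemma path_ne_zero [Nontrivial R] (hl : D.Normal l v) :
    D.path R v l ≠ 0 := by
  rw [path_of_normal hl]
  exact Finsupp.single_ne_zero.2 one_ne_zero

lemma coeff_of_normal (h : D.Normal l v) (n : D.PathModule R v) :
    D.coeff R v l n = n ⟨l, h⟩ := by
  rw [coeff, dif_pos h, Finsupp.lapply_apply]

lemma normal_of_coeff_ne_zero {n : D.PathModule R v} (h : D.coeff R v l n ≠ 0) :
    D.Normal l v := by
  by_contra hl
  exact h (by rw [coeff, dif_neg hl, LinearMap.zero_apply])

open Classical in
lemma coeff_path (hl : D.Normal l v) :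
    D.coeff R v l (D.path R v k) = if l = k then 1 else 0 := by
  by_cases hk : D.Normal k v
  · rw [coeff_of_normal hl, path_of_normal hk, Finsupp.single_apply]
    simp only [Subtype.mk.injEq, eq_comm]
  · rw [path_of_not_normal hk, map_zero, if_neg]
    rintro rfl
    exact hk hl

lemma sum_smul_path (n : D.PathModule R v) :
    n.sum (fun p r => r • D.path R v p.1) = n := by
  conv_rhs => rw [← n.sum_single]
  refine Finsupp.sum_congr fun p _ => ?_
  rw [path_of_normal p.2, Finsupp.smul_single_one]

lemma linearMap_ext {M : Type*} [AddCommMonoid M] [Module R M] {f g : D.PathModule R v →ₗ[R] M}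
    (h : ∀ l, D.Normal l v → f (D.path R v l) = g (D.path R v l)) : f = g := by
  refine Finsupp.lhom_ext fun p r => ?_
  rw [← Finsupp.smul_single_one, ← path_of_normal p.2, map_smul, map_smul, h p.1 p.2]

lemma letterMap_path_eq_act (x : Letter S) (h : D.Normal l v) :
    D.letterMap R v x (D.path R v l) = D.act R v x l := by
  rw [letterMap, path_of_normal h, Finsupp.linearCombination_single, one_smul]

lemma letterMap_path (h : ∀ y ∈ l.head?, ¬ D.Forbidden x y) :
    D.letterMap R v x (D.path R v l) = D.path R v (x :: l) := by
  by_cases hl : D.Normal l v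
  · rw [letterMap_path_eq_act x hl]
    rcases l with _ | ⟨y, l⟩
    · rfl
    · exact if_neg fun hy => h y rfl hy.2
  · rw [path_of_not_normal hl, path_of_not_normal fun hxl => hl (Normal.tail hxl), map_zero]

lemma letterMap_path_of_forbidden (h : D.Forbidden x y) (hx : x.Valid E)
    (hl : D.Normal (y :: l) v) :
    D.letterMap R v x (D.path R v (y :: l)) = D.reduct R v x y l := by
  rw [letterMap_path_eq_act x hl]
  exact if_pos ⟨hx, h⟩

lemma letterMap_of_not_valid (hx : ¬ x.Valid E) (n : D.PathModule R v) :
    D.letterMap R v x n = 0 := by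
  suffices D.letterMap R v x = 0 by rw [this, LinearMap.zero_apply]
  refine linearMap_ext fun l hl => ?_
  rw [letterMap_path_eq_act x hl, LinearMap.zero_apply]
  rcases l with _ | ⟨y, l⟩
  · exact path_of_not_normal fun hxl => hx hxl.valid
  · exact (if_neg fun hy => hx hy.1).trans (path_of_not_normal fun hxl => hx hxl.valid)

lemma letterMap_path_of_rng_ne (h : x.rng E ≠ pathSrc E l v) :
    D.letterMap R v x (D.path R v l) = 0 := by
  rcases head_not_forbidden_or (D := D) x l with hhead | ⟨y, k, rfl, hxy⟩
  · rw [letterMap_path hhead, path_of_not_normal fun hxl => h (Normal.rng_eq hxl)]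
  · exact absurd hxy.rng_eq_src h

open Classical in
lemma letterMap_path_add_sum_replacements (h : D.Forbidden x y) (hx : x.Valid E)
    (hl : D.Normal (y :: l) v) :
    D.letterMap R v x (D.path R v (y :: l)) +
        ∑ p ∈ E.replacements x y, D.letterMap R v p.1 (D.path R v (p.2 :: l)) =
      if y = x.star then D.path R v l else 0 := by
  rw [letterMap_path_of_forbidden h hx hl, reduct, sub_add, sub_eq_self, sub_eq_zero]
  refine Finset.sum_congr rfl fun p hp => (letterMap_path ?_).symm
  rintro _ ⟨⟩
  exact h.not_forbidden_replacement hp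

open Classical in
lemma vertexMap_path (u : V) (l : List (Letter S)) :
    D.vertexMap R v u (D.path R v l) = if pathSrc E l v = u then D.path R v l else 0 := by
  by_cases hl : D.Normal l v
  · rw [vertexMap, path_of_normal hl, Finsupp.linearCombination_single, one_smul,
      ← path_of_normal hl]
  · rw [path_of_not_normal hl, map_zero, ite_self]

lemma vertexMap_path_of_pathSrc_eq (h : pathSrc E l v = u) :
    D.vertexMap R v u (D.path R v l) = D.path R v l := by
  rw [vertexMap_path, if_pos h]

lemma vertexMap_path_nil (v : V) : D.vertexMap R v v (D.path R v []) = D.path R v [] :=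
  vertexMap_path_of_pathSrc_eq rfl

open Classical in
lemma coeff_vertexMap (u : V) (l : List (Letter S)) (n : D.PathModule R v) :
    D.coeff R v l (D.vertexMap R v u n) = if pathSrc E l v = u then D.coeff R v l n else 0 := by
  by_cases hl : D.Normal l v
  · suffices D.coeff R v l ∘ₗ D.vertexMap R v u =
        if pathSrc E l v = u then D.coeff R v l else 0 by
      rw [← LinearMap.comp_apply, this]
      split_ifs <;> rfl
    refine linearMap_ext fun k _ => ?_
    rw [LinearMap.comp_apply, vertexMap_path, apply_ite (D.coeff R v l), map_zero,
      apply_ite (fun f : D.PathModule R v →ₗ[R] R => f (D.path R v k)), LinearMap.zero_apply,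
      coeff_path hl]
    grind
  · simp [coeff, hl]

lemma exists_vertexMap_ne_zero {n : D.PathModule R v} (hn : n ≠ 0) :
    ∃ u, D.vertexMap R v u n ≠ 0 := by
  obtain ⟨p, hp⟩ := Finsupp.ne_iff.1 hn
  refine ⟨pathSrc E p.1 v, fun h => hp ?_⟩
  have hcoeff := coeff_vertexMap (pathSrc E p.1 v) p.1 n
  rwa [h, map_zero, if_pos rfl, coeff_of_normal p.2, eq_comm] at hcoeff

open Classical in
lemma vertexMap_vertexMap (u u' : V) (n : D.PathModule R v) :
    D.vertexMap R v u (D.vertexMap R v u' n) = if u = u' then D.vertexMap R v u n else 0 := by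
  suffices D.vertexMap R v u ∘ₗ D.vertexMap R v u' = if u = u' then D.vertexMap R v u else 0 by
    rw [← LinearMap.comp_apply, this]
    split_ifs <;> rfl
  refine linearMap_ext fun l _ => ?_
  rw [LinearMap.comp_apply, vertexMap_path, apply_ite (D.vertexMap R v u), map_zero,
    apply_ite (fun f : D.PathModule R v →ₗ[R] D.PathModule R v => f (D.path R v l)),
    LinearMap.zero_apply, vertexMap_path]
  grind

lemma letterMap_vertexMap_rng (x : Letter S) (n : D.PathModule R v) :
    D.letterMap R v x (D.vertexMap R v (x.rng E) n) = D.letterMap R v x n := by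
  suffices D.letterMap R v x ∘ₗ D.vertexMap R v (x.rng E) = D.letterMap R v x by
    rw [← LinearMap.comp_apply, this]
  refine linearMap_ext fun l _ => ?_
  rw [LinearMap.comp_apply, vertexMap_path]
  split_ifs with h
  · rfl
  · rw [map_zero, letterMap_path_of_rng_ne (Ne.symm h)]

lemma vertexMap_src_reduct (h : D.Forbidden x y) (hl : D.Normal (y :: l) v) :
    D.vertexMap R v (x.src E) (D.reduct R v x y l) = D.reduct R v x y l := by
  rw [reduct, map_sub, map_sum]
  congr 1
  · split_ifs with hy
    · exact vertexMap_path_of_pathSrc_eq (by rw [← hl.rng_eq, hy, x.rng_star])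
    · exact map_zero _
  · refine Finset.sum_congr rfl fun p hp => ?_
    exact vertexMap_path_of_pathSrc_eq (h.src_replacement hp)

lemma vertexMap_src_letterMap (x : Letter S) (n : D.PathModule R v) :
    D.vertexMap R v (x.src E) (D.letterMap R v x n) = D.letterMap R v x n := by
  suffices D.vertexMap R v (x.src E) ∘ₗ D.letterMap R v x = D.letterMap R v x by
    rw [← LinearMap.comp_apply, this]
  refine linearMap_ext fun l hl => ?_
  rw [LinearMap.comp_apply]
  by_cases hx : x.Valid E
  · rcases head_not_forbidden_or (D := D) x l with hhead | ⟨y, k, rfl, hxy⟩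
    · rw [letterMap_path hhead, vertexMap_path, pathSrc, if_pos rfl]
    · rw [letterMap_path_of_forbidden hxy hx hl, vertexMap_src_reduct hxy hl]
  · rw [letterMap_of_not_valid hx, map_zero]

lemma letterMap_letterMap_of_rng_ne_src (h : x.rng E ≠ y.src E) (n : D.PathModule R v) :
    D.letterMap R v x (D.letterMap R v y n) = 0 := by
  rw [← vertexMap_src_letterMap y, ← letterMap_vertexMap_rng x, vertexMap_vertexMap, if_neg h,
    map_zero]

end SpecialEdges

/-! ### Confluence of the reductions -/

lemma eq_of_sum_eq_sum_of_forall_ne {ι M : Type*} [AddCommGroup M] {s : Finset ι} {f g : ι → M}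
    {a : ι} (ha : a ∈ s) (hsum : ∑ i ∈ s, f i = ∑ i ∈ s, g i)
    (hne : ∀ i ∈ s, i ≠ a → f i = g i) : f a = g a := by
  rw [← sub_eq_zero, ← Finset.sum_sub_distrib] at hsum
  exact sub_eq_zero.1 <|
    Finset.eq_zero_of_sum_eq_zero hsum (fun i hi h => sub_eq_zero.2 (hne i hi h)) a ha

namespace SpecialEdges

section Relations

variable {D : E.SpecialEdges} {R : Type w} [Ring R] {v : V} {l : List (Letter S)} {α β σ η : S}
  {i j m : ℕ}

lemma forbidden_edge_ghost (hσ : σ = D.special (E.src σ)) :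
    D.Forbidden (.edge σ i) (.ghost σ j) := ⟨rfl, hσ⟩

lemma forbidden_ghost_edge (h : E.src α = E.src β) :
    D.Forbidden (.ghost α 0) (.edge β 0) := ⟨rfl, rfl, h⟩

lemma not_forbidden_ghost_edge (hi : i ≠ 0) : ¬ D.Forbidden (.ghost α i) (.edge β i) :=
  fun h => hi h.1

open Classical in
lemma sum_edge_path_ghost (hσ : σ = D.special (E.src σ)) (hi : i < E.weight σ)
    (hl : D.Normal (.ghost σ j :: l) v) :
    ∑ γ ∈ E.emitted (E.src σ), D.letterMap R v (.edge γ i) (D.path R v (.ghost γ j :: l)) =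
      if i = j then D.path R v l else 0 := by
  have key := letterMap_path_add_sum_replacements (R := R) (forbidden_edge_ghost hσ) hi hl
  rw [sum_replacements_edge_ghost fun p => D.letterMap R v p.1 (D.path R v (p.2 :: l))] at key
  rw [← Finset.add_sum_erase _ _ (mem_emitted.2 rfl : σ ∈ E.emitted (E.src σ)), key]
  simp only [Letter.star, Letter.ghost.injEq, true_and, eq_comm]

open Classical in
lemma sum_ghost_path_edge (hsrc : E.src α = E.src β) (hm : E.weight α ≤ m)
    (hl : D.Normal (.edge β 0 :: l) v) :
    ∑ k ∈ Finset.range m, D.letterMap R v (.ghost α k) (D.path R v (.edge β k :: l)) =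
      if α = β then D.path R v l else 0 := by
  have key := letterMap_path_add_sum_replacements (R := R) (forbidden_ghost_edge hsrc)
    (E.weight_pos α) hl
  rw [sum_replacements_ghost_edge fun p => D.letterMap R v p.1 (D.path R v (p.2 :: l)),
    ← Finset.sum_range_eq_add_Ico
      (fun k => D.letterMap R v (.ghost α k) (D.path R v (.edge β k :: l))) (E.weight_pos α)] at key
  rw [← Finset.sum_subset (Finset.range_subset_range.2 hm), key]
  · simp only [Letter.star, Letter.edge.injEq, and_true, eq_comm]
  · intro k _ hk
    exact letterMap_of_not_valid (x := .ghost α k) (fun h => hk (Finset.mem_range.2 h)) _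

lemma Normal.edge (hl : D.Normal (.edge η i :: l) v) (hj : j < E.weight η) :
    D.Normal (.edge η j :: l) v :=
  ⟨hj, hl.rng_eq, fun y hy => by cases y <;> exact hl.head _ hy, hl.tail⟩

lemma Normal.ghost_head (hl : D.Normal (.ghost β j :: l) v) (hsrc : E.src α = E.src β) :
    ∀ y ∈ l.head?, ¬ D.Forbidden (.ghost α j) y := by
  intro y hy h
  refine hl.head y hy ?_
  rcases y with ⟨γ, k⟩ | ⟨γ, k⟩
  · exact ⟨h.1, h.2.1, hsrc.symm.trans h.2.2⟩
  · exact h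

lemma Normal.ghost (hl : D.Normal (.ghost β j :: l) v) (hsrc : E.src α = E.src β)
    (hj : j < E.weight α) : D.Normal (.ghost α j :: l) v :=
  ⟨hj, hsrc.trans hl.rng_eq, hl.ghost_head hsrc, hl.tail⟩

lemma sum_edge_ghost_path_of_forall_not_forbidden {u : V} (hi : i < E.vertexWeight u)
    (hj : j < E.vertexWeight u) (hl : D.Normal l v) (hu : pathSrc E l v = u)
    (hhead : ∀ α, E.src α = u → ∀ y ∈ l.head?, ¬ D.Forbidden (.ghost α j) y) :
    ∑ α ∈ E.emitted u, D.letterMap R v (.edge α i) (D.letterMap R v (.ghost α j) (D.path R v l)) =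
      if i = j then D.path R v l else 0 := by
  obtain ⟨α, rfl⟩ := exists_src_eq_of_lt_vertexWeight hi
  set σ := D.special (E.src α) with hσ
  have hsrc : E.src σ = E.src α := D.src_special α
  rw [← D.weight_special α, ← hσ] at hi hj
  have hσl : D.Normal (.ghost σ j :: l) v := ⟨hj, hsrc.trans hu.symm, hhead σ hsrc, hl⟩
  rw [← hsrc] at hσ hhead ⊢
  convert sum_edge_path_ghost (R := R) hσ hi hσl using 2 with γ hγ
  rw [letterMap_path (hhead γ (mem_emitted.1 hγ))]

/-- The two ways of reducing `α_i α_1^* η_1 l` agree: summed over all `k`, the elements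
`∑_α α_i α_k^* η_k l` and `δ_{ik} η_k l` have the same sum by relation (4), and for `k ≠ 0` they are
equal by relation (3), as `α_k^* η_k` is irreducible. -/
lemma sum_edge_ghost_path_edge (hi : i < E.vertexWeight (E.src η))
    (hl : D.Normal (.edge η 0 :: l) v) :
    ∑ α ∈ E.emitted (E.src η), D.letterMap R v (.edge α i)
        (D.letterMap R v (.ghost α 0) (D.path R v (.edge η 0 :: l))) =
      if i = 0 then D.path R v (.edge η 0 :: l) else 0 := by
  classical
  set W := E.vertexWeight (E.src η)
  let f (k : ℕ) := ∑ α ∈ E.emitted (E.src η), D.letterMap R v (.edge α i)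
    (D.letterMap R v (.ghost α k) (D.path R v (.edge η k :: l)))
  let g (k : ℕ) := if i = k then D.path R v (.edge η k :: l) else 0
  have hf : ∑ k ∈ Finset.range W, f k = D.path R v (.edge η i :: l) := calc
    _ = ∑ α ∈ E.emitted (E.src η), D.letterMap R v (.edge α i) (∑ k ∈ Finset.range W,
          D.letterMap R v (.ghost α k) (D.path R v (.edge η k :: l))) := by
      rw [Finset.sum_comm]
      simp only [map_sum]
    _ = ∑ α ∈ E.emitted (E.src η),
          if α = η then D.letterMap R v (.edge α i) (D.path R v l) else 0 := by
      refine Finset.sum_congr rfl fun α hα => ?_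
      have hsrc := mem_emitted.1 hα
      rw [sum_ghost_path_edge hsrc ((weight_le_vertexWeight α).trans_eq (by rw [hsrc])) hl,
        apply_ite (D.letterMap R v (.edge α i)), map_zero]
    _ = D.path R v (.edge η i :: l) := by
      rw [Finset.sum_ite_eq' _ η, if_pos (mem_emitted.2 rfl), letterMap_path]
      exact fun y hy => by cases y <;> exact hl.head _ hy
  have hg : ∑ k ∈ Finset.range W, g k = D.path R v (.edge η i :: l) := by
    rw [Finset.sum_ite_eq, if_pos (Finset.mem_range.2 hi)]
  suffices f 0 = g 0 by convert this
  refine eq_of_sum_eq_sum_of_forall_ne (Finset.mem_range.2 (by omega)) (hf.trans hg.symm)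
    fun k hk hk0 => ?_
  by_cases hkη : k < E.weight η
  · refine sum_edge_ghost_path_of_forall_not_forbidden hi (Finset.mem_range.1 hk) (hl.edge hkη) rfl
      ?_
    rintro α - _ ⟨⟩
    exact not_forbidden_ghost_edge hk0
  · have hpath : D.path R v (.edge η k :: l) = 0 := path_of_not_normal fun h => hkη h.valid
    simp [f, g, hpath]

lemma sum_edge_ghost {u : V} (hi : i < E.vertexWeight u) (hj : j < E.vertexWeight u)
    (n : D.PathModule R v) :
    ∑ α ∈ E.emitted u, D.letterMap R v (.edge α i) (D.letterMap R v (.ghost α j) n) =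
      if i = j then D.vertexMap R v u n else 0 := by
  suffices ∑ α ∈ E.emitted u, D.letterMap R v (.edge α i) ∘ₗ D.letterMap R v (.ghost α j) =
      if i = j then D.vertexMap R v u else 0 by
    simpa [apply_ite (fun φ : Module.End R (D.PathModule R v) => φ n)] using
      LinearMap.congr_fun this n
  refine linearMap_ext fun l hl => ?_
  simp only [LinearMap.sum_apply, LinearMap.comp_apply,
    apply_ite (fun φ : Module.End R (D.PathModule R v) => φ (D.path R v l)), vertexMap_path,
    LinearMap.zero_apply]
  by_cases hu : pathSrc E l v = u
  · rw [if_pos hu]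
    by_cases hhead : ∀ α, E.src α = u → ∀ y ∈ l.head?, ¬ D.Forbidden (.ghost α j) y
    · exact sum_edge_ghost_path_of_forall_not_forbidden hi hj hl hu hhead
    · push Not at hhead
      obtain ⟨α, -, ⟨η, k⟩ | _, hy, hα⟩ := hhead
      · obtain ⟨rfl, rfl, -⟩ := hα
        obtain ⟨l, rfl⟩ := List.head?_eq_some_iff.1 hy
        subst hu
        exact sum_edge_ghost_path_edge hi hl
      · exact hα.elim
  · rw [if_neg hu, ite_self]
    refine Finset.sum_eq_zero fun α hα => ?_
    rw [letterMap_path_of_rng_ne (x := .ghost α j)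
      (fun h => hu (h.symm.trans (mem_emitted.1 hα))), map_zero]

open Classical in
lemma sum_ghost_edge_path_of_forall_not_forbidden (hsrc : E.src α = E.src β)
    (hm : E.weight α ≤ m) (hl : D.Normal l v) (hβ : pathSrc E l v = E.rng β)
    (hhead : ∀ k, ∀ y ∈ l.head?, ¬ D.Forbidden (.edge β k) y) :
    ∑ k ∈ Finset.range m, D.letterMap R v (.ghost α k)
        (D.letterMap R v (.edge β k) (D.path R v l)) = if α = β then D.path R v l else 0 := by
  have hβl : D.Normal (.edge β 0 :: l) v := ⟨E.weight_pos β, hβ.symm, hhead 0, hl⟩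
  convert sum_ghost_path_edge (R := R) hsrc hm hβl using 3 with k
  rw [letterMap_path (hhead k)]

open Classical in
/-- As in `sum_edge_ghost_path_edge`, the two ways of reducing `α_1^* β_1 β_j^* l` are compared by
letting `β` vary: relation (3) computes the sum over all `γ` of `∑_k α_k^* γ_k γ_j^* l`, and
relation (4) computes each summand for which `γ` is not special. -/
lemma sum_ghost_edge_path_ghost (hsrc : E.src α = E.src β) (hβ : β = D.special (E.src β))
    (hm : E.weight α ≤ m) (hl : D.Normal (.ghost β j :: l) v) :
    ∑ k ∈ Finset.range m, D.letterMap R v (.ghost α k)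
        (D.letterMap R v (.edge β k) (D.path R v (.ghost β j :: l))) =
      if α = β then D.path R v (.ghost β j :: l) else 0 := by
  have hweight : E.weight α ≤ E.weight β := by
    rw [hβ, D.weight_special, ← hsrc]
    exact weight_le_vertexWeight α
  let f (γ : S) := ∑ k ∈ Finset.range m, D.letterMap R v (.ghost α k)
    (D.letterMap R v (.edge γ k) (D.path R v (.ghost γ j :: l)))
  let g (γ : S) := if α = γ then D.path R v (.ghost γ j :: l) else 0
  have hf : ∑ γ ∈ E.emitted (E.src β), f γ = D.path R v (.ghost α j :: l) := calc
    _ = ∑ k ∈ Finset.range m, D.letterMap R v (.ghost α k) (∑ γ ∈ E.emitted (E.src β),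
          D.letterMap R v (.edge γ k) (D.path R v (.ghost γ j :: l))) := by
      rw [Finset.sum_comm]
      simp only [map_sum]
    _ = ∑ k ∈ Finset.range m, if k = j then D.letterMap R v (.ghost α k) (D.path R v l) else 0 := by
      refine Finset.sum_congr rfl fun k _ => ?_
      by_cases hk : k < E.weight α
      · rw [sum_edge_path_ghost hβ (hk.trans_le hweight) hl,
          apply_ite (D.letterMap R v (.ghost α k)), map_zero]
      · have hzero := letterMap_of_not_valid (D := D) (R := R) (v := v) (x := .ghost α k) hk
        simp only [hzero, ite_self]
    _ = D.path R v (.ghost α j :: l) := by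
      rw [Finset.sum_ite_eq', ← letterMap_path (hl.ghost_head hsrc), ite_eq_left_iff]
      intro hj
      refine (letterMap_of_not_valid (fun h => hj ?_) _).symm
      exact Finset.mem_range.2 (lt_of_lt_of_le h hm)
  have hg : ∑ γ ∈ E.emitted (E.src β), g γ = D.path R v (.ghost α j :: l) := by
    rw [Finset.sum_ite_eq, if_pos (mem_emitted.2 hsrc)]
  refine eq_of_sum_eq_sum_of_forall_ne (f := f) (g := g) (mem_emitted.2 rfl) (hf.trans hg.symm)
    fun γ hγ hne => ?_
  have hγ := mem_emitted.1 hγ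
  by_cases hj : j < E.weight γ
  · refine sum_ghost_edge_path_of_forall_not_forbidden (hsrc.trans hγ.symm) hm (hl.ghost hγ hj) rfl
      ?_
    rintro k _ ⟨⟩ ⟨-, hspecial⟩
    exact hne (by rw [hspecial, hγ, ← hβ])
  · have hpath : D.path R v (.ghost γ j :: l) = 0 := path_of_not_normal fun h => hj h.valid
    simp [f, g, hpath]

open Classical in
lemma sum_ghost_edge (α β : S) (hm : E.weight α ≤ m) (n : D.PathModule R v) :
    ∑ k ∈ Finset.range m, D.letterMap R v (.ghost α k) (D.letterMap R v (.edge β k) n) =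
      if α = β then D.vertexMap R v (E.rng α) n else 0 := by
  suffices ∑ k ∈ Finset.range m, D.letterMap R v (.ghost α k) ∘ₗ D.letterMap R v (.edge β k) =
      if α = β then D.vertexMap R v (E.rng α) else 0 by
    simpa [apply_ite (fun φ : Module.End R (D.PathModule R v) => φ n)] using
      LinearMap.congr_fun this n
  refine linearMap_ext fun l hl => ?_
  simp only [LinearMap.sum_apply, LinearMap.comp_apply,
    apply_ite (fun φ : Module.End R (D.PathModule R v) => φ (D.path R v l)), vertexMap_path,
    LinearMap.zero_apply]
  by_cases hsrc : E.src α = E.src β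
  swap
  · rw [if_neg fun h => hsrc (congrArg E.src h)]
    exact Finset.sum_eq_zero fun k _ =>
      letterMap_letterMap_of_rng_ne_src (x := .ghost α k) (y := .edge β k) hsrc _
  by_cases hβ : pathSrc E l v = E.rng β
  · rw [show (if α = β then if pathSrc E l v = E.rng α then D.path R v l else 0 else 0) =
      if α = β then D.path R v l else 0 by grind]
    by_cases hhead : ∀ k, ∀ y ∈ l.head?, ¬ D.Forbidden (.edge β k) y
    · exact sum_ghost_edge_path_of_forall_not_forbidden hsrc hm hl hβ hhead
    · push Not at hhead
      obtain ⟨k, _ | ⟨γ, j⟩, hy, hγ⟩ := hhead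
      · exact hγ.elim
      · obtain ⟨rfl, hspecial⟩ := hγ
        obtain ⟨l, rfl⟩ := List.head?_eq_some_iff.1 hy
        exact sum_ghost_edge_path_ghost hsrc hspecial hm hl
  · rw [Finset.sum_eq_zero fun k _ => ?_]
    · grind
    · rw [letterMap_path_of_rng_ne (Ne.symm hβ), map_zero]

end Relations
end SpecialEdges

/-! ### Words in the Leavitt path algebra -/

/-- The non-unital variant of `MonoidAlgebra.liftNCRingHom`. -/
noncomputable def liftNCNonUnital {k G A : Type*} [Semiring k] [Semigroup G] [Semiring A]
    (f : k →+* A) (g : G →ₙ* A) (h : ∀ r a, Commute (f r) (g a)) : MonoidAlgebra k G →ₙ+* A :=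
  { MonoidAlgebra.liftNC (f : k →+ A) g with
    map_mul' := fun x y => MonoidAlgebra.liftNC_mul f g x y fun {_ _} _ => h _ _ }

lemma liftNCNonUnital_single {k G A : Type*} [Semiring k] [Semigroup G] [Semiring A]
    (f : k →+* A) (g : G →ₙ* A) (h : ∀ r a, Commute (f r) (g a)) (a : G) (r : k) :
    liftNCNonUnital f g h (MonoidAlgebra.single a r) = f r * g a :=
  MonoidAlgebra.liftNC_single _ _ _ _

section LeavittPathAlgebra

variable (R : Type w) [Ring R] (E : WeightedGraph V S)

/-- The quotient map onto the weighted Leavitt path algebra. -/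
noncomputable def toLPA : FreeRRing R E →ₙ+* LeavittPathAlgebra R E where
  toFun x := (x : (leavittIdeal R E).ringCon.Quotient)
  map_mul' _ _ := rfl
  map_zero' := rfl
  map_add' _ _ := rfl

/-- A letter as an element of the free `R`-ring, which is zero unless the letter is valid. -/
noncomputable def letter : Letter S → FreeRRing R E
  | .edge α i => edg R E α i
  | .ghost α i => gho R E α i

/-- The word `l` as an element of the free `R`-ring. The vertex `v` is appended so that the empty
word makes sense. -/
noncomputable def word : List (Letter S) → V → FreeRRing R E
  | [], v => vtx R E v
  | x :: l, v => letter R E x * word l v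

variable {R E} {x : Letter S} {l : List (Letter S)} {u v : V}

lemma toLPA_surjective : Function.Surjective (toLPA R E) := Quotient.mk_surjective

lemma toLPA_eq_iff {x y : FreeRRing R E} :
    toLPA R E x = toLPA R E y ↔ x - y ∈ leavittIdeal R E :=
  (RingCon.eq _).trans (TwoSidedIdeal.rel_iff _ _ _)

lemma smul_mem_leavittIdeal (r : R) {x : FreeRRing R E} (hx : x ∈ leavittIdeal R E) :
    r • x ∈ leavittIdeal R E := by
  rw [leavittIdeal, TwoSidedIdeal.mem_sInf] at hx ⊢
  exact fun J hJ => hJ.1 r x (hx J hJ)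

lemma toLPA_smul_congr (r : R) {x y : FreeRRing R E} (h : toLPA R E x = toLPA R E y) :
    toLPA R E (r • x) = toLPA R E (r • y) := by
  rw [toLPA_eq_iff] at h ⊢
  rw [← smul_sub]
  exact smul_mem_leavittIdeal r h

lemma toLPA_eq_of_rel {x y : FreeRRing R E} (h : LeavittRel R E x y) :
    toLPA R E x = toLPA R E y := by
  rw [toLPA_eq_iff, leavittIdeal, TwoSidedIdeal.mem_sInf]
  exact fun J hJ => hJ.2.2 _ _ h

lemma letter_of_not_valid (h : ¬ x.Valid E) : letter R E x = 0 := by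
  cases x <;> exact dif_neg h

lemma FreeRRing.induction {p : FreeRRing R E → Prop} (zero : p 0) (vtx : ∀ u, p (vtx R E u))
    (letter : ∀ x, p (letter R E x)) (mul : ∀ x y, p x → p y → p (x * y))
    (add : ∀ x y, p x → p y → p (x + y)) (smul : ∀ (r : R) x, p x → p (r • x))
    (x : FreeRRing R E) : p x := by
  have gen (g : E.Generator) : p (gen R E g) := by
    rcases g with u | ⟨α, i⟩ | ⟨α, i⟩
    · exact vtx u
    · simpa only [WeightedGraph.letter, edg, i.2, dif_pos] using letter (.edge α i)
    · simpa only [WeightedGraph.letter, gho, i.2, dif_pos] using letter (.ghost α i)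
  have single_one (a : FreeSemigroup E.Generator) : p (MonoidAlgebra.single a 1) := by
    induction a using FreeSemigroup.recOnMul with
    | ih1 g => exact gen g
    | ih2 g a hg ha => simpa using mul _ _ hg ha
  induction x using MonoidAlgebra.induction_linear with
  | zero => exact zero
  | add x y hx hy => exact add x y hx hy
  | single a r => simpa using smul r _ (single_one a)

lemma gen_mul_smul (g : E.Generator) (r : R) (x : FreeRRing R E) :
    gen R E g * r • x = r • (gen R E g * x) := by
  induction x using MonoidAlgebra.induction_linear with
  | zero => simp
  | add x y hx hy => rw [smul_add, mul_add, hx, hy, mul_add, smul_add]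
  | single a s => simp [gen]

lemma letter_mul_smul (x : Letter S) (r : R) (y : FreeRRing R E) :
    letter R E x * r • y = r • (letter R E x * y) := by
  rcases x with ⟨α, i⟩ | ⟨α, i⟩ <;> simp only [letter, edg, gho] <;> split_ifs <;>
    simp only [gen_mul_smul, zero_mul, smul_zero]

open Classical in
lemma toLPA_vtx_mul_vtx (u v : V) :
    toLPA R E (vtx R E u) * toLPA R E (vtx R E v) = if u = v then toLPA R E (vtx R E u) else 0 := by
  rw [← map_mul, toLPA_eq_of_rel (.vertex_mul u v), apply_ite (toLPA R E), map_zero]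

lemma toLPA_vtx_src_mul_letter (x : Letter S) :
    toLPA R E (vtx R E (x.src E)) * toLPA R E (letter R E x) = toLPA R E (letter R E x) := by
  by_cases h : x.Valid E
  · cases x with
    | edge α i => exact toLPA_eq_of_rel (.src_mul_edge α i h)
    | ghost α i => exact toLPA_eq_of_rel (.rng_mul_ghost α i h)
  · rw [letter_of_not_valid h, map_zero, mul_zero]

lemma toLPA_letter_mul_vtx_rng (x : Letter S) :
    toLPA R E (letter R E x) * toLPA R E (vtx R E (x.rng E)) = toLPA R E (letter R E x) := by
  by_cases h : x.Valid E
  · cases x with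
    | edge α i => exact toLPA_eq_of_rel (.edge_mul_rng α i h)
    | ghost α i => exact toLPA_eq_of_rel (.ghost_mul_src α i h)
  · rw [letter_of_not_valid h, map_zero, zero_mul]

lemma toLPA_vtx_pathSrc_mul_word (l : List (Letter S)) (v : V) :
    toLPA R E (vtx R E (pathSrc E l v)) * toLPA R E (word R E l v) = toLPA R E (word R E l v) := by
  cases l with
  | nil => exact (toLPA_vtx_mul_vtx v v).trans (if_pos rfl)
  | cons x l => rw [pathSrc, word, map_mul, ← mul_assoc, toLPA_vtx_src_mul_letter]

open Classical in
lemma toLPA_vtx_mul_word (u : V) (l : List (Letter S)) (v : V) :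
    toLPA R E (vtx R E u) * toLPA R E (word R E l v) =
      if pathSrc E l v = u then toLPA R E (word R E l v) else 0 := by
  rw [← toLPA_vtx_pathSrc_mul_word, ← mul_assoc, toLPA_vtx_mul_vtx]
  split_ifs <;> simp_all

lemma toLPA_letter_mul_word_of_rng_ne (h : x.rng E ≠ pathSrc E l v) :
    toLPA R E (letter R E x) * toLPA R E (word R E l v) = 0 := by
  rw [← toLPA_letter_mul_vtx_rng, mul_assoc, toLPA_vtx_mul_word, if_neg h.symm, mul_zero]

open Classical in
lemma toLPA_sum_gho_mul_edg (α β : S) :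
    ∑ k ∈ Finset.range (E.weight α), toLPA R E (gho R E α k) * toLPA R E (edg R E β k) =
      if α = β then toLPA R E (vtx R E (E.rng α)) else 0 := by
  rw [Finset.sum_subset (Finset.range_subset_range.2 (le_max_left _ (E.weight β)))]
  · simp only [← map_mul, ← map_sum]
    rw [toLPA_eq_of_rel (.sum_ghost_edge α β), apply_ite (toLPA R E), map_zero]
  · intro k _ hk
    rw [gho, dif_neg fun h => hk (Finset.mem_range.2 h), map_zero, zero_mul]

lemma eventually_toLPA_mul_sum_vtx (x : FreeRRing R E) : ∀ᶠ s : Finset V in Filter.atTop,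
    toLPA R E x * ∑ v ∈ s, toLPA R E (vtx R E v) = toLPA R E x := by
  classical
  have of_mul_vtx {a : LeavittPathAlgebra R E} {v : V} (h : a * toLPA R E (vtx R E v) = a) :
      ∀ᶠ s : Finset V in Filter.atTop, a * ∑ v ∈ s, toLPA R E (vtx R E v) = a := by
    filter_upwards [Filter.eventually_ge_atTop {v}] with s hs
    have hv : v ∈ s := hs (Finset.mem_singleton_self v)
    rw [← h, mul_assoc, Finset.mul_sum]
    simp only [toLPA_vtx_mul_vtx, Finset.sum_ite_eq, hv, if_true]
  induction x using FreeRRing.induction with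
  | zero => simp
  | vtx u => exact of_mul_vtx ((toLPA_vtx_mul_vtx u u).trans (if_pos rfl))
  | letter x => exact of_mul_vtx (toLPA_letter_mul_vtx_rng x)
  | mul x y _ hy =>
    filter_upwards [hy] with s hs
    rw [map_mul, mul_assoc, hs]
  | add x y hx hy =>
    filter_upwards [hx, hy] with s hxs hys
    rw [map_add, add_mul, hxs, hys]
  | smul r x hx =>
    filter_upwards [hx] with s hs
    rw [← map_sum, ← map_mul] at hs ⊢
    rw [smul_mul_assoc, toLPA_smul_congr r hs]

namespace SpecialEdges

variable {D : E.SpecialEdges} {y : Letter S}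

lemma toLPA_sum_edg_mul_gho {σ : S} {i j : ℕ} (hσ : σ = D.special (E.src σ))
    (hi : i < E.weight σ) (hj : j < E.weight σ) :
    ∑ γ ∈ E.emitted (E.src σ), toLPA R E (edg R E γ i) * toLPA R E (gho R E γ j) =
      if i = j then toLPA R E (vtx R E (E.src σ)) else 0 := by
  rw [hσ, D.weight_special] at hi hj
  simp only [← map_mul, ← map_sum]
  rw [toLPA_eq_of_rel (.sum_edge_ghost _ i j hi hj), apply_ite (toLPA R E), map_zero]

open Classical in
lemma toLPA_letter_mul_letter_add_sum (h : D.Forbidden x y) (hx : x.Valid E) (hy : y.Valid E) :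
    toLPA R E (letter R E x) * toLPA R E (letter R E y) +
        ∑ p ∈ E.replacements x y, toLPA R E (letter R E p.1) * toLPA R E (letter R E p.2) =
      if y = x.star then toLPA R E (vtx R E (x.src E)) else 0 := by
  obtain ⟨σ, i, j, rfl, rfl, hσ⟩ | ⟨α, β, rfl, rfl, -⟩ := h.cases
  · rw [sum_replacements_edge_ghost]
    simp only [letter]
    rw [Finset.add_sum_erase _ (fun γ => toLPA R E (edg R E γ i) * toLPA R E (gho R E γ j))
      (mem_emitted.2 rfl), toLPA_sum_edg_mul_gho hσ hx hy]
    simp only [Letter.star, Letter.src, Letter.ghost.injEq, true_and, eq_comm]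
  · rw [sum_replacements_ghost_edge]
    simp only [letter]
    rw [← Finset.sum_range_eq_add_Ico (fun k => toLPA R E (gho R E α k) * toLPA R E (edg R E β k))
      (E.weight_pos α), toLPA_sum_gho_mul_edg]
    simp only [Letter.star, Letter.src, Letter.edge.injEq, and_true, eq_comm]

variable (D R v) in
/-- The element of the free `R`-ring represented by a combination of irreducible paths. -/
noncomputable def embed : D.PathModule R v →ₗ[R] FreeRRing R E :=
  Finsupp.linearCombination R fun p : D.NormalPath v => word R E p.1 v

lemma embed_path (h : D.Normal l v) : D.embed R v (D.path R v l) = word R E l v := by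
  rw [embed, path_of_normal h, Finsupp.linearCombination_single, one_smul]

lemma embed_path_replacement {x' y' : Letter S} (h : D.Forbidden x y) (hl : D.Normal (y :: l) v)
    (hp : (x', y') ∈ E.replacements x y) :
    D.embed R v (D.path R v (x' :: y' :: l)) = letter R E x' * (letter R E y' * word R E l v) := by
  by_cases hx' : x'.Valid E
  · by_cases hy' : y'.Valid E
    · rw [embed_path (h.normal_replacement hp hl hx' hy'), word, word]
    · rw [letter_of_not_valid hy', path_of_not_normal fun hn => hy' hn.tail.valid, map_zero,
        zero_mul, mul_zero]
  · rw [letter_of_not_valid hx', path_of_not_normal fun hn => hx' hn.valid, map_zero, zero_mul]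

lemma toLPA_embed_reduct (h : D.Forbidden x y) (hx : x.Valid E) (hl : D.Normal (y :: l) v) :
    toLPA R E (D.embed R v (D.reduct R v x y l)) =
      toLPA R E (letter R E x) * toLPA R E (word R E (y :: l) v) := by
  classical
  have hstar : toLPA R E (D.embed R v (if y = x.star then D.path R v l else 0)) =
      (if y = x.star then toLPA R E (vtx R E (x.src E)) else 0) * toLPA R E (word R E l v) := by
    split_ifs with hy
    · rw [embed_path hl.tail, toLPA_vtx_mul_word, if_pos]
      rw [← hl.rng_eq, hy, x.rng_star]
    · rw [map_zero, map_zero, zero_mul]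
  have hsum : ∑ p ∈ E.replacements x y,
      toLPA R E (D.embed R v (D.path R v (p.1 :: p.2 :: l))) =
      (∑ p ∈ E.replacements x y, toLPA R E (letter R E p.1) * toLPA R E (letter R E p.2)) *
        toLPA R E (word R E l v) := by
    rw [Finset.sum_mul]
    refine Finset.sum_congr rfl fun p hp => ?_
    rw [embed_path_replacement h hl hp, map_mul, map_mul, mul_assoc]
  rw [reduct, map_sub, map_sub, map_sum, map_sum, hstar, hsum,
    ← toLPA_letter_mul_letter_add_sum h hx hl.valid, add_mul, add_sub_cancel_right, word, map_mul,
    mul_assoc]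

lemma toLPA_letter_mul_word (x : Letter S) (hl : D.Normal l v) :
    toLPA R E (letter R E x) * toLPA R E (word R E l v) =
      toLPA R E (D.embed R v (D.letterMap R v x (D.path R v l))) := by
  by_cases hx : x.Valid E
  · by_cases hrng : x.rng E = pathSrc E l v
    · rcases head_not_forbidden_or (D := D) x l with hhead | ⟨y, k, rfl, hxy⟩
      · have hxl : D.Normal (x :: l) v := ⟨hx, hrng, hhead, hl⟩
        rw [letterMap_path hhead, embed_path hxl, word, map_mul]
      · rw [letterMap_path_of_forbidden hxy hx hl, toLPA_embed_reduct hxy hx hl]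
    · rw [toLPA_letter_mul_word_of_rng_ne hrng, letterMap_path_of_rng_ne hrng, map_zero, map_zero]
  · rw [letter_of_not_valid hx, letterMap_of_not_valid hx, map_zero, map_zero, map_zero, zero_mul]

lemma toLPA_mul_embed_of_word {x : FreeRRing R E} (hx : ∀ (r : R) y, x * r • y = r • (x * y))
    {f : D.PathModule R v →ₗ[R] D.PathModule R v}
    (h : ∀ l, D.Normal l v → toLPA R E x * toLPA R E (word R E l v) =
      toLPA R E (D.embed R v (f (D.path R v l))))
    (n : D.PathModule R v) :
    toLPA R E (x * D.embed R v n) = toLPA R E (D.embed R v (f n)) := by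
  induction n using Finsupp.induction_linear with
  | zero => simp only [map_zero, mul_zero]
  | add m n hm hn => simp only [map_add, mul_add, hm, hn]
  | single p r =>
    rw [← Finsupp.smul_single_one, ← path_of_normal p.2, map_smul, map_smul, map_smul, hx]
    refine toLPA_smul_congr r ?_
    rw [map_mul, embed_path p.2, h p.1 p.2]

end SpecialEdges
end LeavittPathAlgebra

/-! ### The representation on the path module -/

namespace SpecialEdges

section Representation

variable (D : E.SpecialEdges) (R : Type w) [Ring R] (v : V)

/-- The action of a generator on the path module. -/
noncomputable def genMap : E.Generator → D.PathModule R v →ₗ[R] D.PathModule R v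
  | .vertex u => D.vertexMap R v u
  | .edge α i => D.letterMap R v (.edge α i)
  | .ghost α i => D.letterMap R v (.ghost α i)

/-- The action of words in the generators on the path module. -/
noncomputable def genWordMap : FreeSemigroup E.Generator →ₙ* AddMonoid.End (D.PathModule R v) :=
  FreeSemigroup.lift fun g => (D.genMap R v g).toAddMonoidHom

variable {D R v}

lemma genWordMap_smul (a : FreeSemigroup E.Generator) (r : R) (n : D.PathModule R v) :
    D.genWordMap R v a (r • n) = r • D.genWordMap R v a n := by
  induction a using FreeSemigroup.recOnMul generalizing n with
  | ih1 g => exact (D.genMap R v g).map_smul r n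
  | ih2 g a hg ha =>
    rw [map_mul]
    exact (congrArg _ (ha n)).trans (hg _)

lemma commute_genWordMap (r : R) (a : FreeSemigroup E.Generator) :
    Commute (Module.toAddMonoidEnd R (D.PathModule R v) r) (D.genWordMap R v a) :=
  AddMonoidHom.ext fun n => (genWordMap_smul a r n).symm

variable (D R v) in
/-- The representation of the free `R`-ring on the path module, which factors through the Leavitt
path algebra. -/
noncomputable def rep : FreeRRing R E →ₙ+* AddMonoid.End (D.PathModule R v) :=
  liftNCNonUnital (Module.toAddMonoidEnd R (D.PathModule R v)) (D.genWordMap R v)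
    commute_genWordMap

lemma rep_single (a : FreeSemigroup E.Generator) (r : R) (n : D.PathModule R v) :
    D.rep R v (MonoidAlgebra.single a r) n = r • D.genWordMap R v a n := by
  rw [rep, liftNCNonUnital_single]
  rfl

lemma rep_mul (x y : FreeRRing R E) (n : D.PathModule R v) :
    D.rep R v (x * y) n = D.rep R v x (D.rep R v y n) := by
  rw [map_mul]
  rfl

lemma rep_add (x y : FreeRRing R E) (n : D.PathModule R v) :
    D.rep R v (x + y) n = D.rep R v x n + D.rep R v y n := by
  rw [map_add]
  rfl

lemma rep_sum {ι : Type*} (s : Finset ι) (f : ι → FreeRRing R E) (n : D.PathModule R v) :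
    D.rep R v (∑ i ∈ s, f i) n = ∑ i ∈ s, D.rep R v (f i) n := by
  rw [map_sum]
  exact AddMonoidHom.finsetSum_apply _ _ _

@[simp]
lemma rep_zero (n : D.PathModule R v) : D.rep R v 0 n = 0 := by
  rw [map_zero]
  rfl

lemma rep_smul (r : R) (x : FreeRRing R E) (n : D.PathModule R v) :
    D.rep R v (r • x) n = r • D.rep R v x n := by
  induction x using MonoidAlgebra.induction_linear with
  | zero => simp
  | add x y hx hy => rw [smul_add, rep_add, hx, hy, rep_add, smul_add]
  | single a s => rw [MonoidAlgebra.smul_single, rep_single, rep_single, smul_smul, smul_eq_mul]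

lemma rep_op_smul (r : R) (x : FreeRRing R E) (n : D.PathModule R v) :
    D.rep R v (MulOpposite.op r • x) n = D.rep R v x (r • n) := by
  induction x using MonoidAlgebra.induction_linear with
  | zero => simp
  | add x y hx hy => rw [smul_add, rep_add, hx, hy, rep_add]
  | single a s =>
    rw [MonoidAlgebra.smul_single, rep_single, rep_single, genWordMap_smul, smul_smul,
      op_smul_eq_mul]

lemma rep_gen (g : E.Generator) (n : D.PathModule R v) :
    D.rep R v (gen R E g) n = D.genMap R v g n :=
  (rep_single _ _ _).trans (one_smul _ _)

lemma rep_vtx (u : V) (n : D.PathModule R v) :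
    D.rep R v (vtx R E u) n = D.vertexMap R v u n :=
  rep_gen _ n

lemma rep_letter (x : Letter S) (n : D.PathModule R v) :
    D.rep R v (letter R E x) n = D.letterMap R v x n := by
  by_cases h : x.Valid E
  · cases x with
    | edge α i => exact (congrArg (D.rep R v · n) (dif_pos h)).trans (rep_gen _ n)
    | ghost α i => exact (congrArg (D.rep R v · n) (dif_pos h)).trans (rep_gen _ n)
  · rw [letter_of_not_valid h, letterMap_of_not_valid h, rep_zero]

lemma rep_edg (α : S) (i : ℕ) (n : D.PathModule R v) :
    D.rep R v (edg R E α i) n = D.letterMap R v (.edge α i) n := rep_letter (.edge α i) n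

lemma rep_gho (α : S) (i : ℕ) (n : D.PathModule R v) :
    D.rep R v (gho R E α i) n = D.letterMap R v (.ghost α i) n := rep_letter (.ghost α i) n

lemma rep_eq_of_rel {x y : FreeRRing R E} (h : LeavittRel R E x y) (n : D.PathModule R v) :
    D.rep R v x n = D.rep R v y n := by
  classical
  have rep_ite (p : Prop) [Decidable p] (u : V) :
      D.rep R v (if p then vtx R E u else 0) n = if p then D.vertexMap R v u n else 0 := by
    split_ifs
    · rw [rep_vtx]
    · rw [rep_zero]
  cases h with
  | vertex_mul u w => rw [rep_mul, rep_vtx, rep_vtx, vertexMap_vertexMap, rep_ite]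
  | src_mul_edge α i hi =>
    rw [rep_mul, rep_vtx, rep_edg]
    exact vertexMap_src_letterMap (.edge α i) n
  | edge_mul_rng α i hi =>
    rw [rep_mul, rep_vtx, rep_edg, rep_edg]
    exact letterMap_vertexMap_rng (.edge α i) n
  | rng_mul_ghost α i hi =>
    rw [rep_mul, rep_vtx, rep_gho]
    exact vertexMap_src_letterMap (.ghost α i) n
  | ghost_mul_src α i hi =>
    rw [rep_mul, rep_vtx, rep_gho, rep_gho]
    exact letterMap_vertexMap_rng (.ghost α i) n
  | sum_edge_ghost u i j hi hj =>
    simp only [rep_sum, rep_mul, rep_edg, rep_gho]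
    rw [sum_edge_ghost hi hj, rep_ite]
  | sum_ghost_edge α β =>
    simp only [rep_sum, rep_mul, rep_edg, rep_gho]
    rw [sum_ghost_edge α β (le_max_left _ _), rep_ite]

lemma mem_ker_rep_iff {x : FreeRRing R E} :
    x ∈ TwoSidedIdeal.ker (D.rep R v) ↔ ∀ n, D.rep R v x n = 0 :=
  (TwoSidedIdeal.mem_ker _).trans DFunLike.ext_iff

lemma rep_eq_zero_of_mem_leavittIdeal {x : FreeRRing R E} (hx : x ∈ leavittIdeal R E)
    (n : D.PathModule R v) : D.rep R v x n = 0 := by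
  rw [leavittIdeal, TwoSidedIdeal.mem_sInf] at hx
  refine mem_ker_rep_iff.1 (hx _ ⟨fun r y hy => ?_, fun r y hy => ?_, fun y z h => ?_⟩) n
  · rw [mem_ker_rep_iff] at hy ⊢
    intro n
    rw [rep_smul, hy, smul_zero]
  · rw [mem_ker_rep_iff] at hy ⊢
    intro n
    rw [rep_op_smul, hy]
  · rw [TwoSidedIdeal.mem_ker, map_sub, sub_eq_zero]
    exact AddMonoidHom.ext (rep_eq_of_rel h)

lemma rep_congr {x y : FreeRRing R E} (h : toLPA R E x = toLPA R E y) (n : D.PathModule R v) :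
    D.rep R v x n = D.rep R v y n := by
  have hxy := rep_eq_zero_of_mem_leavittIdeal (toLPA_eq_iff.1 h) n
  rw [map_sub] at hxy
  exact sub_eq_zero.1 hxy

lemma toLPA_ne_zero_of_rep {x : FreeRRing R E} {n : D.PathModule R v} (h : D.rep R v x n ≠ 0) :
    toLPA R E x ≠ 0 := fun hx =>
  h ((rep_congr (hx.trans (map_zero _).symm) n).trans (rep_zero n))

lemma toLPA_mul_embed (x : FreeRRing R E) (n : D.PathModule R v) :
    toLPA R E (x * D.embed R v n) = toLPA R E (D.embed R v (D.rep R v x n)) := by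
  induction x using FreeRRing.induction generalizing n with
  | zero => simp
  | vtx u =>
    rw [rep_vtx]
    refine toLPA_mul_embed_of_word (gen_mul_smul _) (fun l hl => ?_) n
    classical
    rw [← vtx, toLPA_vtx_mul_word, vertexMap_path]
    split_ifs
    · rw [embed_path hl]
    · rw [map_zero, map_zero]
  | letter x =>
    rw [rep_letter]
    exact toLPA_mul_embed_of_word (letter_mul_smul x) (fun l hl => toLPA_letter_mul_word x hl) n
  | mul x y hx hy => rw [mul_assoc, map_mul, hy, ← map_mul, hx, rep_mul]
  | add x y hx hy => rw [add_mul, map_add, hx, hy, ← map_add, ← map_add, rep_add]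
  | smul r x hx => rw [smul_mul_assoc, toLPA_smul_congr r (hx n), rep_smul, (D.embed R v).map_smul]

lemma rep_embed_rep (x : FreeRRing R E) (n : D.PathModule R v) {w : V} (m : D.PathModule R w) :
    D.rep R w (D.embed R v (D.rep R v x n)) m = D.rep R w x (D.rep R w (D.embed R v n) m) := by
  rw [← rep_congr (toLPA_mul_embed x n), rep_mul]

lemma exists_rep_path_nil_ne_zero (D : E.SpecialEdges) {x : FreeRRing R E}
    (hx : toLPA R E x ≠ 0) : ∃ v, D.rep R v x (D.path R v []) ≠ 0 := by
  by_contra! h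
  obtain ⟨s, hs⟩ := (eventually_toLPA_mul_sum_vtx x).exists
  refine hx (hs.symm.trans ?_)
  rw [Finset.mul_sum]
  refine Finset.sum_eq_zero fun v _ => ?_
  rw [← map_mul, ← word, ← embed_path (D := D) normal_nil, toLPA_mul_embed, h, map_zero,
    map_zero]

end Representation
end SpecialEdges

/-! ### Products of words -/

namespace SpecialEdges

section LeadingCoefficients

variable (D : E.SpecialEdges) (R : Type w) [Ring R] (v : V)

/-- Left multiplication by a word. -/
noncomputable def wordMap (l : List (Letter S)) : Module.End R (D.PathModule R v) :=
  (l.map (D.letterMap R v)).prod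

/-- The span of the irreducible paths of length at most `d`. -/
noncomputable def lengthLE (d : ℕ) : Submodule R (D.PathModule R v) :=
  Submodule.span R (D.path R v '' {l | l.length ≤ d})

/-- `Replaces p q p' q'` says that the reduction of the word `p' q'` at the junction of `p'` and
`q'` yields `p q` as one of its summands of the same length. -/
def Replaces (p q p' q' : List (Letter S)) : Prop :=
  ∃ l x y x' y' k, p = l ++ [x] ∧ q = y :: k ∧ p' = l ++ [x'] ∧ q' = y' :: k ∧
    D.Forbidden x' y' ∧ (x, y) ∈ E.replacements x' y'

variable {D R v} {u w : V} {x y x' y' : Letter S} {l k p q p' q' N : List (Letter S)} {d : ℕ}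

lemma wordMap_cons (x : Letter S) (l : List (Letter S)) (n : D.PathModule R v) :
    D.wordMap R v (x :: l) n = D.letterMap R v x (D.wordMap R v l n) := by
  rw [wordMap, List.map_cons, List.prod_cons]
  rfl

lemma wordMap_append (l k : List (Letter S)) (n : D.PathModule R v) :
    D.wordMap R v (l ++ k) n = D.wordMap R v l (D.wordMap R v k n) := by
  rw [wordMap, List.map_append, List.prod_append]
  rfl

lemma rep_word (l : List (Letter S)) (n : D.PathModule R v) :
    D.rep R v (word R E l u) n = D.wordMap R v l (D.vertexMap R v u n) := by
  induction l with
  | nil => exact rep_vtx u n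
  | cons x l ih => rw [word, rep_mul, rep_letter, ih, wordMap_cons]

lemma rep_embed (m : D.PathModule R u) (n : D.PathModule R v) :
    D.rep R v (D.embed R u m) n =
      m.sum fun p a => a • D.wordMap R v p.1 (D.vertexMap R v u n) := by
  rw [embed, Finsupp.linearCombination_apply, Finsupp.sum, rep_sum]
  exact Finset.sum_congr rfl fun p _ => by rw [rep_smul, rep_word]

lemma coeff_rep_embed {m : D.PathModule R u} {n : D.PathModule R v}
    (hn : D.vertexMap R v u n = n) (N : List (Letter S)) :
    D.coeff R v N (D.rep R v (D.embed R u m) n) =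
      m.sum fun p a => n.sum fun q b =>
        a * (b * D.coeff R v N (D.wordMap R v p.1 (D.path R v q.1))) := by
  rw [rep_embed, hn, map_finsuppSum]
  refine Finsupp.sum_congr fun p _ => ?_
  conv_lhs => rw [← sum_smul_path n]
  simp only [map_smul, map_finsuppSum, Finsupp.mul_sum, smul_eq_mul]

lemma wordMap_path (hl : D.Normal l w) (h : ∀ x ∈ l.getLast?, ∀ y ∈ k.head?, ¬ D.Forbidden x y) :
    D.wordMap R v l (D.path R v k) = D.path R v (l ++ k) := by
  induction l with
  | nil => rfl
  | cons x l ih =>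
    rw [wordMap_cons]
    rcases l with _ | ⟨z, l⟩
    · exact letterMap_path (h x rfl)
    · rw [ih hl.tail h]
      exact letterMap_path hl.head

lemma path_mem_lengthLE (h : l.length ≤ d) : D.path R v l ∈ D.lengthLE R v d :=
  Submodule.subset_span ⟨l, h, rfl⟩

lemma letterMap_path_mem_lengthLE (x : Letter S) (hl : l.length ≤ d) :
    D.letterMap R v x (D.path R v l) ∈ D.lengthLE R v (d + 1) := by
  by_cases hxl : D.Normal l v ∧ x.Valid E
  · rcases head_not_forbidden_or (D := D) x l with hhead | ⟨y, k, rfl, hxy⟩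
    · rw [letterMap_path hhead]
      exact path_mem_lengthLE (Nat.succ_le_succ hl)
    · rw [letterMap_path_of_forbidden hxy hxl.2 hxl.1, reduct]
      rw [List.length_cons] at hl
      refine sub_mem ?_ (sum_mem fun p _ => path_mem_lengthLE (Nat.succ_le_succ hl))
      split_ifs
      · exact path_mem_lengthLE (by lia)
      · exact zero_mem _
  · rcases not_and_or.1 hxl with hl | hx
    · rw [path_of_not_normal hl, map_zero]
      exact zero_mem _
    · rw [letterMap_of_not_valid hx]
      exact zero_mem _

lemma letterMap_mem_lengthLE (x : Letter S) {n : D.PathModule R v} (hn : n ∈ D.lengthLE R v d) :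
    D.letterMap R v x n ∈ D.lengthLE R v (d + 1) := by
  refine Submodule.span_le (p := (D.lengthLE R v (d + 1)).comap (D.letterMap R v x)).2 ?_ hn
  rintro _ ⟨l, hl, rfl⟩
  exact letterMap_path_mem_lengthLE x hl

lemma wordMap_path_mem_lengthLE (l k : List (Letter S)) :
    D.wordMap R v l (D.path R v k) ∈ D.lengthLE R v (l.length + k.length) := by
  induction l with
  | nil => exact path_mem_lengthLE (Nat.le_add_left _ _)
  | cons x l ih =>
    rw [wordMap_cons, List.length_cons, Nat.add_right_comm]
    exact letterMap_mem_lengthLE x ih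

lemma coeff_eq_zero_of_mem_lengthLE {n : D.PathModule R v} (hn : n ∈ D.lengthLE R v d)
    (hN : D.Normal N v) (hd : d < N.length) : D.coeff R v N n = 0 := by
  classical
  refine Submodule.span_le (p := LinearMap.ker (D.coeff R v N)).2 ?_ hn
  rintro _ ⟨l, hl, rfl⟩
  refine (coeff_path hN).trans (if_neg ?_)
  rintro rfl
  exact absurd hl hd.not_ge

open Classical in
lemma wordMap_path_of_forbidden (h : D.Forbidden x y) (hl : D.Normal (l ++ [x]) u)
    (hk : D.Normal (y :: k) v) :
    D.wordMap R v (l ++ [x]) (D.path R v (y :: k)) =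
      (if y = x.star then D.wordMap R v l (D.path R v k) else 0) -
        ∑ r ∈ E.replacements x y, D.path R v (l ++ r.1 :: r.2 :: k) := by
  obtain ⟨hl, hx, hjunction⟩ := normal_append_iff.1 hl
  rw [wordMap_append, wordMap_cons]
  change D.wordMap R v l (D.letterMap R v x (D.path R v (y :: k))) = _
  rw [letterMap_path_of_forbidden h hx.valid hk, reduct, map_sub, map_sum,
    apply_ite (D.wordMap R v l), map_zero]
  congr 1
  refine Finset.sum_congr rfl fun r hr => wordMap_path hl ?_
  rintro z hz _ ⟨⟩ hzr
  exact hjunction z hz x rfl (h.of_replacement_left hr hzr)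

lemma replaces_concat_cons_iff (h : D.Forbidden x y) :
    D.Replaces p q (l ++ [x]) (y :: k) ↔
      ∃ r ∈ E.replacements x y, p = l ++ [r.1] ∧ q = r.2 :: k := by
  constructor
  · rintro ⟨l', x₁, y₁, x', y', k', rfl, rfl, hp, hq, -, hr⟩
    obtain ⟨rfl, hx⟩ := List.append_inj' hp rfl
    obtain rfl := List.singleton_inj.1 hx
    obtain ⟨rfl, rfl⟩ := List.cons.inj hq
    exact ⟨_, hr, rfl, rfl⟩
  · rintro ⟨r, hr, rfl, rfl⟩
    exact ⟨l, _, _, x, y, k, rfl, rfl, rfl, rfl, h, hr⟩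

lemma Replaces.exists_forbidden (h : D.Replaces p q p' q') :
    ∃ x ∈ p'.getLast?, ∃ y ∈ q'.head?, D.Forbidden x y := by
  obtain ⟨l, x, y, x', y', k, -, -, rfl, rfl, hxy, -⟩ := h
  exact ⟨x', List.getLast?_concat, y', rfl, hxy⟩

lemma getLast_head_not_forbidden_or (p q : List (Letter S)) :
    (∀ x ∈ p.getLast?, ∀ y ∈ q.head?, ¬ D.Forbidden x y) ∨
      ∃ l x y k, p = l ++ [x] ∧ q = y :: k ∧ D.Forbidden x y := by
  refine or_iff_not_imp_left.2 fun h => ?_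
  simp only [not_forall, not_not] at h
  obtain ⟨x, hx, y, hy, hxy⟩ := h
  obtain ⟨l, rfl⟩ := List.getLast?_eq_some_iff.1 hx
  obtain ⟨k, rfl⟩ := List.head?_eq_some_iff.1 hy
  exact ⟨l, x, y, k, rfl, rfl, hxy⟩

end LeadingCoefficients
end SpecialEdges

/-! ### Coefficients of products -/

lemma append_eq_append_iff_of_length_le {T : Type*} {p q p' q' : List T}
    (hp : p'.length ≤ p.length) (hq : q'.length ≤ q.length) :
    p ++ q = p' ++ q' ↔ p' = p ∧ q' = q := by
  constructor
  · intro h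
    have hlen := congrArg List.length h
    simp only [List.length_append] at hlen
    obtain ⟨rfl, rfl⟩ := List.append_inj h (by lia)
    exact ⟨rfl, rfl⟩
  · rintro ⟨rfl, rfl⟩
    rfl

namespace SpecialEdges

variable {D : E.SpecialEdges} {R : Type w} [Ring R] {u v : V} {x y x' y' : Letter S}
  {l k p q p' q' p₀ q₀ : List (Letter S)}

open Classical in
lemma sum_coeff_append_path_replacements (hpq : D.Normal (p ++ q) v) (hxy : D.Forbidden x y)
    (hp : (l ++ [x]).length ≤ p.length) (hq : (y :: k).length ≤ q.length) :
    ∑ r ∈ E.replacements x y, D.coeff R v (p ++ q) (D.path R v (l ++ r.1 :: r.2 :: k)) =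
      if D.Replaces p q (l ++ [x]) (y :: k) then 1 else 0 := by
  have coeff_eq (r : Letter S × Letter S) :
      D.coeff R v (p ++ q) (D.path R v (l ++ r.1 :: r.2 :: k)) =
        if p = l ++ [r.1] ∧ q = r.2 :: k then 1 else 0 := by
    have hp' : (l ++ [r.1]).length ≤ p.length := by simpa using hp
    rw [coeff_path hpq, List.append_cons]
    exact if_congr ((append_eq_append_iff_of_length_le (q' := r.2 :: k) hp' hq).trans
      (and_congr eq_comm eq_comm)) rfl rfl
  simp only [coeff_eq, replaces_concat_cons_iff hxy]
  split_ifs with h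
  · obtain ⟨r, hr, rfl, rfl⟩ := h
    refine (Finset.sum_eq_single_of_mem r hr fun r' _ hne => if_neg ?_).trans (if_pos ⟨rfl, rfl⟩)
    rintro ⟨h₁, h₂⟩
    exact hne (Prod.ext (List.singleton_inj.1 (List.append_cancel_left h₁)).symm
      (List.cons.inj h₂).1.symm)
  · exact Finset.sum_eq_zero fun r hr => if_neg fun hr' => h ⟨r, hr, hr'⟩

open Classical in
lemma coeff_append_wordMap_path (hpq : D.Normal (p ++ q) v) (hp' : D.Normal p' u)
    (hq' : D.Normal q' v) (hp : p'.length ≤ p.length) (hq : q'.length ≤ q.length) :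
    D.coeff R v (p ++ q) (D.wordMap R v p' (D.path R v q')) =
      (if p' = p ∧ q' = q then 1 else 0) - if D.Replaces p q p' q' then 1 else 0 := by
  rcases getLast_head_not_forbidden_or (D := D) p' q' with hfree | ⟨l, x, y, k, rfl, rfl, hxy⟩
  · have hrep : ¬ D.Replaces p q p' q' := fun h =>
      let ⟨x, hx, y, hy, hxy⟩ := h.exists_forbidden
      hfree x hx y hy hxy
    rw [wordMap_path hp' hfree, coeff_path hpq, if_neg hrep, sub_zero]
    exact if_congr (append_eq_append_iff_of_length_le hp hq) rfl rfl
  · have hne : ¬ (l ++ [x] = p ∧ y :: k = q) := by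
      rintro ⟨rfl, rfl⟩
      exact (normal_append_iff.1 hpq).2.2 x List.getLast?_concat y rfl hxy
    have hshort : D.coeff R v (p ++ q) (D.wordMap R v l (D.path R v k)) = 0 := by
      refine coeff_eq_zero_of_mem_lengthLE (wordMap_path_mem_lengthLE l k) hpq ?_
      simp only [List.length_append, List.length_cons, List.length_nil] at hp hq ⊢
      lia
    rw [wordMap_path_of_forbidden hxy hp' hq', map_sub, map_sum, if_neg hne,
      sum_coeff_append_path_replacements hpq hxy hp hq, apply_ite (D.coeff R v (p ++ q)), hshort,
      map_zero, ite_self]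

open Classical in
lemma sum_mul_ite_eq (n : D.PathModule R v) (q : List (Letter S)) :
    (n.sum fun q' b => b * if q'.1 = q then 1 else 0) = D.coeff R v q n := by
  by_cases hq : D.Normal q v
  · conv_rhs => rw [← sum_smul_path n]
    simp only [map_finsuppSum, map_smul, smul_eq_mul, coeff_path hq, eq_comm]
  · rw [coeff, dif_neg hq, LinearMap.zero_apply]
    have hne (q' : D.NormalPath v) : q'.1 ≠ q := fun h => hq (h ▸ q'.2)
    simp only [hne, if_false, mul_zero, Finsupp.sum_fun_zero]

open Classical in
lemma sum_sum_mul_ite_and (m : D.PathModule R u) (n : D.PathModule R v)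
    (p q : List (Letter S)) :
    (m.sum fun p' a => n.sum fun q' b => a * (b * if p'.1 = p ∧ q'.1 = q then 1 else 0)) =
      D.coeff R u p m * D.coeff R v q n := by
  rw [← sum_mul_ite_eq m, ← sum_mul_ite_eq n, Finsupp.sum_mul]
  refine Finsupp.sum_congr fun p' _ => ?_
  rw [mul_assoc, Finsupp.mul_sum, Finsupp.mul_sum]
  refine Finsupp.sum_congr fun q' _ => ?_
  split_ifs <;> simp_all

lemma Forbidden.eq_of_mem_replacements {x₁ y₁ x₂ y₂ : Letter S} (h₁ : D.Forbidden x₁ y₁)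
    (h₂ : D.Forbidden x₂ y₂) (hr₁ : (x, y) ∈ E.replacements x₁ y₁)
    (hr₂ : (x, y) ∈ E.replacements x₂ y₂) : x₁ = x₂ ∧ y₁ = y₂ := by
  obtain ⟨α, γ, i, j, rfl, rfl, rfl, rfl, hα, -, hsrc⟩ | ⟨α, β, n, rfl, rfl, rfl, rfl, -⟩ :=
    h₁.replacements_cases hr₁ <;>
  obtain ⟨α', γ', i', j', rfl, rfl, hx, hy, hα', -, hsrc'⟩ |
      ⟨α', β', n', rfl, rfl, hx, hy, -⟩ := h₂.replacements_cases hr₂ <;>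
  cases hx <;> cases hy
  · rw [hα, ← hsrc, hsrc', ← hα']
    exact ⟨rfl, rfl⟩
  · exact ⟨rfl, rfl⟩

lemma Replaces.unique (h : D.Replaces p q p₀ q₀) (h' : D.Replaces p q p' q') :
    p' = p₀ ∧ q' = q₀ := by
  obtain ⟨l, x, y, x₁, y₁, k, rfl, rfl, rfl, rfl, hxy, hr⟩ := h
  obtain ⟨l', x', y', x₂, y₂, k', hp, hq, rfl, rfl, hxy', hr'⟩ := h'
  obtain ⟨rfl, hx⟩ := List.append_inj' hp rfl
  obtain rfl := List.singleton_inj.1 hx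
  obtain ⟨rfl, rfl⟩ := List.cons.inj hq
  obtain ⟨rfl, rfl⟩ := hxy.eq_of_mem_replacements hxy' hr hr'
  exact ⟨rfl, rfl⟩

lemma Replaces.length_left (h : D.Replaces p q p' q') : p'.length = p.length := by
  obtain ⟨l, x, y, x', y', k, rfl, rfl, rfl, rfl, -⟩ := h
  simp only [List.length_append, List.length_singleton]

lemma Replaces.length_right (h : D.Replaces p q p' q') : q'.length = q.length := by
  obtain ⟨l, x, y, x', y', k, rfl, rfl, rfl, rfl, -⟩ := h
  rfl

section LeadingCoefficients

variable {m : D.PathModule R u} {n : D.PathModule R v} (hn : D.vertexMap R v u n = n)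
  (hpq : D.Normal (p ++ q) v) (hp : ∀ p', D.coeff R u p' m ≠ 0 → p'.length ≤ p.length)
  (hq : ∀ q', D.coeff R v q' n ≠ 0 → q'.length ≤ q.length)
include hn hpq hp hq

open Classical in
lemma coeff_append_rep_embed : D.coeff R v (p ++ q) (D.rep R v (D.embed R u m) n) =
    D.coeff R u p m * D.coeff R v q n -
      m.sum fun p' a => n.sum fun q' b => a * (b * if D.Replaces p q p'.1 q'.1 then 1 else 0) := by
  rw [coeff_rep_embed hn, ← sum_sum_mul_ite_and, ← Finsupp.sum_sub]
  refine Finsupp.sum_congr fun p' hp' => ?_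
  rw [← Finsupp.sum_sub]
  refine Finsupp.sum_congr fun q' hq' => ?_
  rw [Finsupp.mem_support_iff, ← coeff_of_normal p'.2] at hp'
  rw [Finsupp.mem_support_iff, ← coeff_of_normal q'.2] at hq'
  rw [coeff_append_wordMap_path hpq p'.2 q'.2 (hp _ hp') (hq _ hq'), mul_sub, mul_sub]

lemma coeff_append_rep_embed_of_forall_not_replaces (h : ∀ p' q', ¬ D.Replaces p q p' q') :
    D.coeff R v (p ++ q) (D.rep R v (D.embed R u m) n) =
      D.coeff R u p m * D.coeff R v q n := by
  rw [coeff_append_rep_embed hn hpq hp hq]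
  simp [h]

lemma coeff_append_rep_embed_of_replaces (h : D.Replaces p q p₀ q₀) :
    D.coeff R v (p ++ q) (D.rep R v (D.embed R u m) n) =
      D.coeff R u p m * D.coeff R v q n - D.coeff R u p₀ m * D.coeff R v q₀ n := by
  classical
  have hiff (p' q' : List (Letter S)) : D.Replaces p q p' q' ↔ p' = p₀ ∧ q' = q₀ :=
    ⟨h.unique, by rintro ⟨rfl, rfl⟩; exact h⟩
  rw [coeff_append_rep_embed hn hpq hp hq]
  simp only [hiff, sum_sum_mul_ite_and]

end LeadingCoefficients

end SpecialEdges

/-! ### Primeness -/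

/-- The words `α_i α_j^*` and `α_i^* β_i`, that is, the two-letter words which occur in the
relations (3) and (4). -/
def Matching : Letter S → Letter S → Prop
  | .edge α _, .ghost β _ => α = β
  | .ghost _ i, .edge _ j => i = j
  | _, _ => False

namespace SpecialEdges

variable {D : E.SpecialEdges} {R : Type w} [Ring R] {u v : V} {x y x' y' : Letter S}
  {p q p' q' : List (Letter S)}

lemma Forbidden.matching (h : D.Forbidden x y) : Matching x y := by
  obtain ⟨α, i, j, rfl, rfl, -⟩ | ⟨α, β, rfl, rfl, -⟩ := h.cases <;> rfl

lemma Forbidden.matching_replacement (h : D.Forbidden x y) (hr : (x', y') ∈ E.replacements x y) :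
    Matching x' y' := by
  obtain ⟨α, γ, i, j, rfl, rfl, rfl, rfl, -⟩ | ⟨α, β, n, rfl, rfl, rfl, rfl, -⟩ :=
    h.replacements_cases hr <;> rfl

lemma Forbidden.not_matching_right (h : D.Forbidden x y) (hr : (x', y') ∈ E.replacements x y) :
    ¬ Matching x y' := by
  obtain ⟨α, γ, i, j, rfl, rfl, rfl, rfl, -, hne, -⟩ | ⟨α, β, n, rfl, rfl, rfl, rfl, -, hn⟩ :=
    h.replacements_cases hr
  · exact hne.symm
  · exact hn.symm

lemma Forbidden.not_matching_left (h : D.Forbidden x y) (hr : (x', y') ∈ E.replacements x y) :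
    ¬ Matching x' y := by
  obtain ⟨α, γ, i, j, rfl, rfl, rfl, rfl, -, hne, -⟩ | ⟨α, β, n, rfl, rfl, rfl, rfl, -, hn⟩ :=
    h.replacements_cases hr
  · exact hne
  · exact hn

lemma Forbidden.exists_valid_replacement (hE : E.IsLVGraph) (h : D.Forbidden x y)
    (hx : x.Valid E) (hy : y.Valid E) :
    ∃ r ∈ E.replacements x y, r.1.Valid E ∧ r.2.Valid E := by
  classical
  obtain ⟨α, i, j, rfl, rfl, -⟩ | ⟨α, β, rfl, rfl, -⟩ := h.cases
  · obtain ⟨γ, hne, hsrc, hweight⟩ := hE.exists_ne_weight_eq α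
    have hle : E.weight α ≤ E.weight γ := hweight ▸ weight_le_vertexWeight α
    exact ⟨_, Finset.mem_image_of_mem _ (Finset.mem_erase.2 ⟨hne, mem_emitted.2 hsrc⟩),
      lt_of_lt_of_le hx hle, lt_of_lt_of_le hy hle⟩
  · exact ⟨_, Finset.mem_image_of_mem _ (Finset.mem_Ico.2 ⟨le_rfl, hE.two_le_weight α⟩),
      hE.two_le_weight α, hE.two_le_weight β⟩

lemma exists_replaces_of_not_normal_append (hE : E.IsLVGraph) (hp : D.Normal p (pathSrc E q v))
    (hq : D.Normal q v) (hpq : ¬ D.Normal (p ++ q) v) :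
    ∃ p' q', D.Replaces p' q' p q ∧ D.Normal (p' ++ q') v := by
  rcases getLast_head_not_forbidden_or (D := D) p q with hfree | ⟨l, x, y, k, rfl, rfl, hxy⟩
  · exact absurd (normal_append_iff.2 ⟨hp, hq, hfree⟩) hpq
  · obtain ⟨hl, hx, hjunction⟩ := normal_append_iff.1 hp
    obtain ⟨r, hr, hr₁, hr₂⟩ := hxy.exists_valid_replacement hE hx.valid hq.valid
    refine ⟨l ++ [r.1], r.2 :: k, (replaces_concat_cons_iff hxy).2 ⟨r, hr, rfl, rfl⟩, ?_⟩
    rw [← List.append_cons, normal_append_iff]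
    refine ⟨?_, hxy.normal_replacement hr hq hr₁ hr₂, ?_⟩
    · rw [pathSrc, hxy.src_replacement hr]
      exact hl
    · rintro z hz _ ⟨⟩ hzr
      exact hjunction z hz x rfl (hxy.of_replacement_left hr hzr)

lemma normal_append_of_not_matching (hp : D.Normal p (pathSrc E q v)) (hq : D.Normal q v)
    (h : ∀ x ∈ p.getLast?, ∀ y ∈ q.head?, ¬ Matching x y) : D.Normal (p ++ q) v :=
  normal_append_iff.2 ⟨hp, hq, fun x hx y hy hxy => h x hx y hy hxy.matching⟩

lemma not_replaces_of_not_matching (h : ∀ x ∈ p.getLast?, ∀ y ∈ q.head?, ¬ Matching x y) :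
    ¬ D.Replaces p q p' q' := by
  rintro ⟨l, x, y, x', y', k, rfl, rfl, -, -, hxy, hr⟩
  exact h x List.getLast?_concat y rfl (hxy.matching_replacement hr)

lemma Replaces.not_matching (h : D.Replaces p q p' q' ∨ D.Replaces p' q' p q) :
    ∀ x ∈ p.getLast?, ∀ y ∈ q'.head?, ¬ Matching x y := by
  rcases h with h | h <;> obtain ⟨l, x, y, x', y', k, rfl, rfl, rfl, rfl, hxy, hr⟩ := h <;>
    rintro _ hz _ ⟨⟩ <;> rw [List.getLast?_concat] at hz <;> cases hz
  · exact hxy.not_matching_left hr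
  · exact hxy.not_matching_right hr

lemma exists_coeff_ne_zero_max_length {n : D.PathModule R v} (hn : n ≠ 0) :
    ∃ q, D.coeff R v q n ≠ 0 ∧ ∀ q', D.coeff R v q' n ≠ 0 → q'.length ≤ q.length := by
  obtain ⟨q, hq, hmax⟩ := n.support.exists_max_image (fun q => q.1.length)
    (Finsupp.support_nonempty_iff.2 hn)
  rw [Finsupp.mem_support_iff, ← coeff_of_normal q.2] at hq
  refine ⟨q.1, hq, fun q' hq' => ?_⟩
  have hnormal := normal_of_coeff_ne_zero hq'
  rw [coeff_of_normal hnormal] at hq'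
  exact hmax ⟨q', hnormal⟩ (Finsupp.mem_support_iff.2 hq')

lemma pathSrc_eq_of_coeff_ne_zero {n : D.PathModule R v} (hn : D.vertexMap R v u n = n)
    (hq : D.coeff R v q n ≠ 0) : pathSrc E q v = u := by
  classical
  by_contra h
  exact hq (by rw [← hn, coeff_vertexMap, if_neg h])

section LeadingCoefficients

variable {m : D.PathModule R u} {n : D.PathModule R v} (hn : D.vertexMap R v u n = n)
  (h : ∀ r : R, D.rep R v (D.embed R u m) (r • n) = 0)
  (hp : ∀ p', D.coeff R u p' m ≠ 0 → p'.length ≤ p.length)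
  (hq : ∀ q', D.coeff R v q' n ≠ 0 → q'.length ≤ q.length) (hpq : D.Normal (p ++ q) v)
include hn h hp hq hpq

lemma coeff_mul_coeff_eq_zero_of_rep_embed_eq_zero (hfree : ∀ p' q', ¬ D.Replaces p q p' q')
    (r : R) : D.coeff R u p m * r * D.coeff R v q n = 0 := by
  have htop := coeff_append_rep_embed_of_forall_not_replaces (n := r • n)
    (by rw [map_smul, hn]) hpq hp (fun q' hq' => hq q' fun h0 => hq' (by simp [h0])) hfree
  rw [h, map_zero, map_smul, smul_eq_mul, ← mul_assoc] at htop
  exact htop.symm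

lemma coeff_mul_coeff_eq_of_rep_embed_eq_zero (hrep : D.Replaces p q p' q') (r : R) :
    D.coeff R u p m * r * D.coeff R v q n = D.coeff R u p' m * r * D.coeff R v q' n := by
  have htop := coeff_append_rep_embed_of_replaces (n := r • n)
    (by rw [map_smul, hn]) hpq hp (fun q' hq' => hq q' fun h0 => hq' (by simp [h0])) hrep
  simp only [h, map_zero, map_smul, smul_eq_mul, ← mul_assoc] at htop
  exact sub_eq_zero.1 htop.symm

end LeadingCoefficients

/-- Suppose that the products all vanish. The leading words `p` and `q` either have a reducible
product or are such that `p q` stems from a reduction; either way there is a pair `p'`, `q'` related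
to `p`, `q` by a reduction with the same leading contribution. In the mixed word `p q'` no reduction
takes part, so its coefficient in the product is that of `p` times that of `q'`. -/
lemma exists_rep_embed_smul_ne_zero (hE : E.IsLVGraph) (hR : IsPrimeRing R)
    {m : D.PathModule R u} {n : D.PathModule R v} (hm : m ≠ 0) (hn : n ≠ 0)
    (hu : D.vertexMap R v u n = n) : ∃ r : R, D.rep R v (D.embed R u m) (r • n) ≠ 0 := by
  by_contra! h
  obtain ⟨p, hp, hpmax⟩ := exists_coeff_ne_zero_max_length hm
  obtain ⟨q, hq, hqmax⟩ := exists_coeff_ne_zero_max_length hn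
  have exists_ne_zero {b : R} (hb : b ≠ 0) : ∃ r, D.coeff R u p m * r * b ≠ 0 := by
    by_contra! h0
    exact (hR.2 _ _ h0).elim hp hb
  have normal_left {q'} (hq' : D.coeff R v q' n ≠ 0) : D.Normal p (pathSrc E q' v) :=
    pathSrc_eq_of_coeff_ne_zero hu hq' ▸ normal_of_coeff_ne_zero hp
  have exists_replaces {q'} (hq' : D.coeff R v q' n ≠ 0) (hlen : q'.length = q.length)
      (hnormal : D.Normal (p ++ q') v) : ∃ p₀ q₀, D.Replaces p q' p₀ q₀ := by
    by_contra! hfree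
    obtain ⟨r, hr⟩ := exists_ne_zero hq'
    exact hr (coeff_mul_coeff_eq_zero_of_rep_embed_eq_zero hu h hpmax (hlen ▸ hqmax) hnormal
      hfree r)
  obtain ⟨p', q', hrep, heq⟩ : ∃ p' q', (D.Replaces p q p' q' ∨ D.Replaces p' q' p q) ∧
      ∀ r, D.coeff R u p m * r * D.coeff R v q n =
        D.coeff R u p' m * r * D.coeff R v q' n := by
    by_cases hpq : D.Normal (p ++ q) v
    · obtain ⟨p', q', hrep⟩ := exists_replaces hq rfl hpq
      exact ⟨p', q', .inl hrep,
        coeff_mul_coeff_eq_of_rep_embed_eq_zero hu h hpmax hqmax hpq hrep⟩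
    · obtain ⟨p', q', hrep, hpq'⟩ := exists_replaces_of_not_normal_append hE (normal_left hq)
        (normal_of_coeff_ne_zero hq) hpq
      exact ⟨p', q', .inr hrep, fun r => (coeff_mul_coeff_eq_of_rep_embed_eq_zero hu h
        (hrep.length_left ▸ hpmax) (hrep.length_right ▸ hqmax) hpq' hrep r).symm⟩
  have hq' : D.coeff R v q' n ≠ 0 := fun h0 => by
    obtain ⟨r, hr⟩ := exists_ne_zero hq
    exact hr (by rw [heq, h0, mul_zero])
  have hlen : q'.length = q.length := hrep.elim Replaces.length_right (·.length_right.symm)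
  have hmatch := Replaces.not_matching hrep
  obtain ⟨p₀, q₀, h₀⟩ := exists_replaces hq' hlen
    (normal_append_of_not_matching (normal_left hq') (normal_of_coeff_ne_zero hq') hmatch)
  exact not_replaces_of_not_matching hmatch h₀

lemma rep_eq_rep_embed {n : D.PathModule R v} (hn : D.vertexMap R v u n = n)
    (x : FreeRRing R E) :
    D.rep R v x n = D.rep R v (D.embed R u (D.rep R u x (D.path R u []))) n := by
  rw [rep_embed_rep, embed_path normal_nil, word, rep_vtx, hn]

lemma exists_rep_smul_ne_zero (hE : E.IsLVGraph) (hR : IsPrimeRing R) {x : FreeRRing R E}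
    (hx : D.rep R u x (D.path R u []) ≠ 0) {n : D.PathModule R v} (hn : n ≠ 0)
    (hu : D.vertexMap R v u n = n) : ∃ r : R, D.rep R v x (r • n) ≠ 0 := by
  obtain ⟨r, hr⟩ := exists_rep_embed_smul_ne_zero hE hR hx hn hu
  refine ⟨r, ?_⟩
  rwa [rep_eq_rep_embed (by rw [map_smul, hu])]

lemma exists_rep_mul_ne_zero_of_valid (hE : E.IsLVGraph) (hR : IsPrimeRing R)
    {x : Letter S} (hx : x.Valid E) {a : FreeRRing R E}
    (ha : D.rep R (x.src E) a (D.path R (x.src E) []) ≠ 0) :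
    ∃ b, D.rep R (x.rng E) (a * b) (D.path R (x.rng E) []) ≠ 0 := by
  have := hR.1
  have hnormal : D.Normal [x] (x.rng E) := ⟨hx, rfl, by simp, trivial⟩
  obtain ⟨r, hr⟩ := exists_rep_smul_ne_zero hE hR ha (path_ne_zero hnormal)
    (vertexMap_path_of_pathSrc_eq rfl)
  refine ⟨r • letter R E x, ?_⟩
  rwa [rep_mul, rep_smul, rep_letter, letterMap_path (by simp)]

lemma exists_rep_mul_ne_zero (hE : E.IsLVGraph) (hR : IsPrimeRing R) {a : FreeRRing R E}
    (h : E.GenReach u v) (ha : D.rep R u a (D.path R u []) ≠ 0) :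
    ∃ b, D.rep R v (a * b) (D.path R v []) ≠ 0 := by
  induction h with
  | trivial =>
    refine ⟨vtx R E u, ?_⟩
    rwa [rep_mul, rep_vtx, vertexMap_path_nil]
  | edge α i _ ih =>
    obtain ⟨b, hb⟩ := ih
    obtain ⟨c, hc⟩ := exists_rep_mul_ne_zero_of_valid hE hR (x := .edge α i) i.2 hb
    exact ⟨b * c, by rwa [← mul_assoc]⟩
  | ghost α i _ ih =>
    obtain ⟨b, hb⟩ := ih
    obtain ⟨c, hc⟩ := exists_rep_mul_ne_zero_of_valid hE hR (x := .ghost α i) i.2 hb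
    exact ⟨b * c, by rwa [← mul_assoc]⟩

end SpecialEdges

open SpecialEdges

lemma LeavittPathAlgebra.nontrivial (R : Type w) [Ring R] [Nontrivial R] [Nonempty V] [Nonempty S] :
    Nontrivial (LeavittPathAlgebra R E) := by
  obtain ⟨D⟩ := nonempty_specialEdges (E := E)
  obtain ⟨v⟩ := ‹Nonempty V›
  refine nontrivial_of_ne (toLPA R E (vtx R E v)) 0
    (toLPA_ne_zero_of_rep (D := D) (v := v) (n := D.path R v []) ?_)
  rw [rep_vtx, vertexMap_path_nil]
  exact path_ne_zero normal_nil

lemma IsLVGraph.exists_toLPA_mul_mul_ne_zero (hE : E.IsLVGraph) {R : Type w} [Ring R]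
    (hR : IsPrimeRing R) {a b : FreeRRing R E} (ha : toLPA R E a ≠ 0) (hb : toLPA R E b ≠ 0) :
    ∃ x, toLPA R E (a * x * b) ≠ 0 := by
  have := hE.nonempty_edges
  obtain ⟨D⟩ := nonempty_specialEdges (E := E)
  obtain ⟨u, hu⟩ := exists_rep_path_nil_ne_zero D ha
  obtain ⟨v, hv⟩ := exists_rep_path_nil_ne_zero D hb
  obtain ⟨w, hw⟩ := exists_vertexMap_ne_zero hv
  obtain ⟨x, hx⟩ := exists_rep_mul_ne_zero hE hR (hE.connected.2 u w) hu
  have hvertex : D.vertexMap R v w (D.vertexMap R v w (D.rep R v b (D.path R v []))) =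
      D.vertexMap R v w (D.rep R v b (D.path R v [])) := by
    rw [vertexMap_vertexMap, if_pos rfl]
  obtain ⟨r, hr⟩ := exists_rep_smul_ne_zero hE hR hx hw hvertex
  refine ⟨x * r • vtx R E w, toLPA_ne_zero_of_rep (D := D) (n := D.path R v []) ?_⟩
  rwa [← mul_assoc, rep_mul, rep_mul, rep_smul, rep_vtx]

end WeightedGraph

lemma isPrimeRing_of_isDomain (R : Type*) [Ring R] [IsDomain R] : IsPrimeRing R :=
  ⟨inferInstance, fun a b h => mul_eq_zero.1 (by simpa using h 1)⟩

theorem mainTheorem9_general {V : Type u} {S : Type v} (E : WeightedGraph V S) (hE : E.IsLVGraph)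
    (R : Type w) [Ring R] (hR : IsPrimeRing R) :
    IsPrimeRing (WeightedGraph.LeavittPathAlgebra R E) := by
  have := hR.1
  have := hE.connected.1
  have := hE.nonempty_edges
  refine ⟨WeightedGraph.LeavittPathAlgebra.nontrivial R, fun a b hab => ?_⟩
  obtain ⟨a, rfl⟩ := WeightedGraph.toLPA_surjective a
  obtain ⟨b, rfl⟩ := WeightedGraph.toLPA_surjective b
  by_contra! h
  obtain ⟨x, hx⟩ := hE.exists_toLPA_mul_mul_ne_zero hR h.1 h.2
  exact hx (by rw [map_mul, map_mul, hab])

theorem mainTheorem9 {V : Type u} {S : Type v} [Countable V] [Countable S]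
    (E : WeightedGraph V S) (hE : E.IsLVGraph) (R : Type w) [Ring R] [IsDomain R] :
    IsPrimeRing (WeightedGraph.LeavittPathAlgebra R E) :=
  mainTheorem9_general E hE R (isPrimeRing_of_isDomain R)
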